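/- Let $n\ge 2$, let $\mathbb T=\mathbb R^n/\mathbb Z^n$, and let $a_{kj}^{\alpha\beta}\in\mathbb R$ ($1\le k,j,\alpha,\beta\le n$) be constants with $a_{kj}^{\alpha\beta}=a_{\alpha j}^{k\beta}=a_{k\beta}^{\alpha j}$ for which there is a constant $C_{\mathbb A}>0$ such that $$\sum_{k,j,\alpha,\beta}a_{kj}^{\alpha\beta}\zeta_{k\alpha}\zeta_{j\beta}\ \ge\ C_{\mathbb A}^{-1}\sum_{k,\alpha}\zeta_{k\alpha}^2$$ for all symmetric real $n\times n$ matrices $\zeta$ with zero trace. For $s\in\mathbb R$ let $H^s_\#$ be the space of complex-valued $1$-periodic distributions $g$ on $\mathbb R^n$ with Fourier coefficients $\hat g(\xi)=\langle g,e^{-2\pi i x\cdot\xi}\rangle_{\mathbb T}$ such that $\sum_{\xi\in\mathbb Z^n}(1+|\xi|^2)^{s}|\hat g(\xi)|^2<\infty$; let $\dot H^s_\#=\{g\in H^s_\#:\langle g,1\rangle_{\mathbb T}=0\}$, $\dot{\mathbf H}^s_\#=(\dot H^s_\#)^n$, $\dot{\mathbf H}^s_{\#\sigma}=\{\mathbf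 w\in\dot{\mathbf H}^s_\#:\operatorname{div}\mathbf w=0\}$, and let $\dot{\mathcal C}^\infty_\#$ be the space of smooth $1$-periodic functions with zero mean over $\mathbb T$. Consider the stationary anisotropic incompressible Navier–Stokes equation, in the sense of periodic distributions, $$-\sum_{\alpha,j,\beta}\partial_\alpha\big(a_{kj}^{\alpha\beta}E_{j\beta}(\mathbf u)\big)+\partial_k p+\big((\mathbf u\cdot\nabla)\mathbf u\big)_k=f_k,\quad k=1,\dots,n,\qquad E_{j\beta}(\mathbf u)=\tfrac12(\partial_j u_\beta+\partial_\beta u_j),\tag{NS}$$ where $(\mathbf u\cdot\nabla)\mathbf u$ is the limit in the sense of distributions of $(\mathbf u_m\cdot\nabla)\mathbf u_m$ as $m\to\infty$, with $\mathbf u_m=\sum_{|\xi|\le m}\hat{\mathbf u}(\xi)e^{2\pi i x\cdot\xi}$. Let $\frac n2-1<s_1<s_2$. (i) If $(\mathbf u,p)\in\dot{\mathbf H}^{s_1}_{\#\sigma}\times\dot H^{s_1-1}_\#$ is a solution of (NS) with $\mathbf f\in\dot{\mathbf H}^{s_2-2}_\#$, then $(\mathbf u,p)\in\dot{\mathbf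 H}^{s_2}_{\#\sigma}\times\dot H^{s_2-1}_\#$. (ii) If $(\mathbf u,p)\in\dot{\mathbf H}^{s_1}_{\#\sigma}\times\dot H^{s_1-1}_\#$ is a solution of (NS) with $\mathbf f\in(\dot{\mathcal C}^\infty_\#)^n$, then $(\mathbf u,p)\in(\dot{\mathcal C}^\infty_\#)^n\times\dot{\mathcal C}^\infty_\#$. -/

import Mathlib

open scoped ContDiff
open Filter Topology MeasureTheory

noncomputable section

namespace PeriodicNS

/-- The algebra `C^∞_#` of smooth complex-valued functions on `ℝⁿ` that are `1`-periodic in every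
coordinate, i.e. of smooth functions on the torus `𝕋 = ℝⁿ / ℤⁿ`. -/
def SmoothPeriodic (n : ℕ) : Subalgebra ℂ ((Fin n → ℝ) → ℂ) where
  carrier := {φ | ContDiff ℝ ∞ φ ∧ ∀ (x : Fin n → ℝ) (ξ : Fin n → ℤ),
    φ (fun j => x j + (ξ j : ℝ)) = φ x}
  mul_mem' := fun ha hb => ⟨ha.1.mul hb.1, fun x ξ => by
    simp only [Pi.mul_apply, ha.2 x ξ, hb.2 x ξ]⟩
  add_mem' := fun ha hb => ⟨ha.1.add hb.1, fun x ξ => by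
    simp only [Pi.add_apply, ha.2 x ξ, hb.2 x ξ]⟩
  algebraMap_mem' := fun c => ⟨contDiff_const (c := c), fun _ _ => rfl⟩

/-- The partial derivative `∂φ/∂x_j` of a smooth periodic function. -/
def partialSmooth {n : ℕ} (j : Fin n) : SmoothPeriodic n →ₗ[ℂ] SmoothPeriodic n where
  toFun φ := ⟨fun x => fderiv ℝ (φ : (Fin n → ℝ) → ℂ) x (Pi.single j 1), by
    refine ⟨(φ.2.1.fderiv_right (by simp)).clm_apply contDiff_const, fun x ξ => ?_⟩
    have h : (fun y : Fin n → ℝ => (φ : (Fin n → ℝ) → ℂ) (y + fun j => (ξ j : ℝ))) = φ := by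
      funext y
      exact φ.2.2 y ξ
    have h2 := fderiv_comp_add_right (𝕜 := ℝ) (f := (φ : (Fin n → ℝ) → ℂ)) (x := x)
      (fun j => (ξ j : ℝ))
    rw [h] at h2
    exact congrArg (fun L => L (Pi.single j 1)) h2.symm⟩
  map_add' φ ψ := by
    ext x
    have hφ : DifferentiableAt ℝ (φ : (Fin n → ℝ) → ℂ) x := (φ.2.1.differentiable (by simp)) x
    have hψ : DifferentiableAt ℝ (ψ : (Fin n → ℝ) → ℂ) x := (ψ.2.1.differentiable (by simp)) x
    change fderiv ℝ ((φ : (Fin n → ℝ) → ℂ) + (ψ : (Fin n → ℝ) → ℂ)) x (Pi.single j 1) = _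
    rw [fderiv_add hφ hψ]
    rfl
  map_smul' c φ := by
    ext x
    have hφ : DifferentiableAt ℝ (φ : (Fin n → ℝ) → ℂ) x := (φ.2.1.differentiable (by simp)) x
    change fderiv ℝ (c • (φ : (Fin n → ℝ) → ℂ)) x (Pi.single j 1) = _
    rw [fderiv_const_smul hφ]
    rfl

/-- The exponential `e_ξ(x) = exp (2 π i x·ξ)`, for `ξ ∈ ℤⁿ`. -/
def expo {n : ℕ} (ξ : Fin n → ℤ) : SmoothPeriodic n :=
  ⟨fun x => Complex.exp (2 * Real.pi * Complex.I * ((∑ j, x j * (ξ j : ℝ) : ℝ) : ℂ)), by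
    refine ⟨?_, fun x η => ?_⟩
    · have h : ContDiff ℝ ∞ (fun x : Fin n → ℝ => ∑ j, x j * (ξ j : ℝ)) :=
        ContDiff.sum fun j _ => (contDiff_apply ℝ ℝ j).mul contDiff_const
      exact Complex.contDiff_exp.comp (contDiff_const.mul (Complex.ofRealCLM.contDiff.comp h))
    · rw [Complex.exp_eq_exp_iff_exists_int]
      refine ⟨∑ j, η j * ξ j, ?_⟩
      push_cast
      simp only [add_mul, Finset.sum_add_distrib]
      ring⟩

/-- Integration over the cube `[0,1)ⁿ`, i.e. over the torus. -/
def integralCube {n : ℕ} : SmoothPeriodic n →ₗ[ℂ] ℂ where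
  toFun φ := ∫ x in Set.univ.pi (fun _ : Fin n => Set.Ico (0 : ℝ) 1), (φ : (Fin n → ℝ) → ℂ) x
  map_add' φ ψ := integral_add
    ((φ.2.1.continuous.integrableOn_Icc (a := 0) (b := 1)).mono_set
      fun _ hx => ⟨fun i => (hx i trivial).1, fun i => (hx i trivial).2.le⟩)
    ((ψ.2.1.continuous.integrableOn_Icc (a := 0) (b := 1)).mono_set
      fun _ hx => ⟨fun i => (hx i trivial).1, fun i => (hx i trivial).2.le⟩)
  map_smul' c _ := integral_const_mul c _

/-- Continuity of a linear functional on `C^∞_#` for the Fréchet topology of uniform convergence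
of all derivatives: for some order `N` and some constant `C`, the bound
`|T φ| ≤ C · max_{m ≤ N} sup_x |D^m φ(x)|` holds. -/
def IsContinuousFunctional {n : ℕ} (T : Module.Dual ℂ (SmoothPeriodic n)) : Prop :=
  ∃ (N : ℕ) (C : ℝ), 0 ≤ C ∧ ∀ (φ : SmoothPeriodic n) (M : ℝ),
    (∀ m ≤ N, ∀ x, ‖iteratedFDeriv ℝ m (φ : (Fin n → ℝ) → ℂ) x‖ ≤ M) → ‖T φ‖ ≤ C * M

/-- The space `D'_#` of (complex) periodic distributions: the topological dual of `C^∞_#`. -/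
def PeriodicDistrib (n : ℕ) : Submodule ℂ (Module.Dual ℂ (SmoothPeriodic n)) where
  carrier := {T | IsContinuousFunctional T}
  zero_mem' := ⟨0, 0, le_rfl, fun φ M _ => by simp⟩
  add_mem' := by
    rintro S T ⟨N, C, hC, h⟩ ⟨N', C', hC', h'⟩
    refine ⟨max N N', C + C', add_nonneg hC hC', fun φ M hM => ?_⟩
    calc ‖S φ + T φ‖ ≤ ‖S φ‖ + ‖T φ‖ := norm_add_le _ _
      _ ≤ C * M + C' * M := add_le_add
          (h φ M fun m hm => hM m (hm.trans (le_max_left _ _)))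
          (h' φ M fun m hm => hM m (hm.trans (le_max_right _ _)))
      _ = (C + C') * M := by ring
  smul_mem' := by
    rintro c T ⟨N, C, hC, h⟩
    refine ⟨N, ‖c‖ * C, by positivity, fun φ M hM => ?_⟩
    calc ‖c • T φ‖ = ‖c‖ * ‖T φ‖ := norm_smul _ _
      _ ≤ ‖c‖ * (C * M) := by gcongr; exact h φ M hM
      _ = ‖c‖ * C * M := by ring

/-- The duality pairing `⟨T, φ⟩` (bilinear, without complex conjugation). -/
def pair {n : ℕ} (T : PeriodicDistrib n) (φ : SmoothPeriodic n) : ℂ :=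
  (T : Module.Dual ℂ (SmoothPeriodic n)) φ

/-- The regular distribution `φ ↦ ∫_𝕋 g φ dx` given by a smooth periodic function `g`. -/
def ofSmooth {n : ℕ} (g : SmoothPeriodic n) : PeriodicDistrib n :=
  ⟨integralCube ∘ₗ LinearMap.mulLeft ℂ g, by
    refine ⟨0, ∫ x in Set.univ.pi (fun _ : Fin n => Set.Ico (0 : ℝ) 1),
      ‖(g : (Fin n → ℝ) → ℂ) x‖, integral_nonneg fun _ => norm_nonneg _, fun φ M hM => ?_⟩
    have hg : IntegrableOn (fun x => ‖(g : (Fin n → ℝ) → ℂ) x‖)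
        (Set.univ.pi (fun _ : Fin n => Set.Ico (0 : ℝ) 1)) :=
      (g.2.1.continuous.norm.integrableOn_Icc (a := 0) (b := 1)).mono_set
        fun x hx => ⟨fun i => (hx i trivial).1, fun i => (hx i trivial).2.le⟩
    rw [← integral_mul_const]
    refine norm_integral_le_of_norm_le (hg.mul_const M) (Eventually.of_forall fun x => ?_)
    change ‖(g : (Fin n → ℝ) → ℂ) x * (φ : (Fin n → ℝ) → ℂ) x‖ ≤ _
    rw [norm_mul]
    gcongr
    simpa using hM 0 le_rfl x⟩

/-- The distributional derivative: `⟨∂_j T, φ⟩ = -⟨T, ∂_j φ⟩`. -/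
def partialD {n : ℕ} (j : Fin n) (T : PeriodicDistrib n) : PeriodicDistrib n :=
  ⟨-((T : Module.Dual ℂ (SmoothPeriodic n)) ∘ₗ partialSmooth j), by
    obtain ⟨N, C, hC, h⟩ := T.2
    refine ⟨N + 1, C, hC, fun φ M hM => ?_⟩
    rw [LinearMap.neg_apply, norm_neg]
    refine h (partialSmooth j φ) M fun m hm x => ?_
    refine le_trans ?_ (hM (m + 1) (by omega) x)
    have hd : ContDiff ℝ ∞ (fderiv ℝ (φ : (Fin n → ℝ) → ℂ)) := φ.2.1.fderiv_right (by simp)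
    have hL : ((partialSmooth j φ : SmoothPeriodic n) : (Fin n → ℝ) → ℂ) =
        (ContinuousLinearMap.apply ℝ ℂ (Pi.single j (1 : ℝ) : Fin n → ℝ)) ∘
          fderiv ℝ (φ : (Fin n → ℝ) → ℂ) := rfl
    rw [hL, ← norm_iteratedFDeriv_fderiv]
    refine (ContinuousLinearMap.norm_iteratedFDeriv_comp_left _ hd.contDiffAt
      (by exact_mod_cast le_top)).trans ?_
    refine mul_le_of_le_one_left (norm_nonneg _) ?_
    refine ContinuousLinearMap.opNorm_le_bound _ zero_le_one fun L => ?_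
    have := L.le_opNorm (Pi.single j (1 : ℝ))
    simpa [Pi.norm_single] using this⟩

/-- The Fourier coefficient `\hat T(ξ) = ⟨T, e_{-ξ}⟩`. -/
def fourierCoeffD {n : ℕ} (T : PeriodicDistrib n) (ξ : Fin n → ℤ) : ℂ := pair T (expo (-ξ))

/-- `ρ(ξ) = (1 + |ξ|²)^{1/2}`, with `|ξ|` the Euclidean norm. -/
def rho {n : ℕ} (ξ : Fin n → ℤ) : ℝ := Real.sqrt (1 + ∑ j, (ξ j : ℝ) ^ 2)

/-- The periodic Sobolev (Bessel-potential) space `H^s_#`: the periodic distributions for which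
`∑_ξ ρ(ξ)^{2s} |\hat T(ξ)|²` converges. -/
def Sobolev (n : ℕ) (s : ℝ) : Set (PeriodicDistrib n) :=
  {T | Summable fun ξ : Fin n → ℤ => rho ξ ^ (2 * s) * ‖fourierCoeffD T ξ‖ ^ 2}

/-- `\dot H^s_# = {T ∈ H^s_# : ⟨T, 1⟩ = 0}`. -/
def SobolevDot (n : ℕ) (s : ℝ) : Set (PeriodicDistrib n) :=
  {T | T ∈ Sobolev n s ∧ pair T 1 = 0}

/-- The vector-valued space `(\dot H^s_#)ⁿ`. -/
def SobolevDotVec (n : ℕ) (s : ℝ) : Set (Fin n → PeriodicDistrib n) :=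
  {u | ∀ k, u k ∈ SobolevDot n s}

/-- The divergence of a vector-valued periodic distribution. -/
def divergence {n : ℕ} (u : Fin n → PeriodicDistrib n) : PeriodicDistrib n := ∑ j, partialD j (u j)

/-- The space `\dot H^s_{#σ}` of divergence-free fields in `(\dot H^s_#)ⁿ`. -/
def SobolevDotSigma (n : ℕ) (s : ℝ) : Set (Fin n → PeriodicDistrib n) :=
  {u | u ∈ SobolevDotVec n s ∧ divergence u = 0}

/-- `\dot C^∞_#` as a set of distributions: those given by a smooth periodic function of
zero mean. -/
def SmoothDot (n : ℕ) : Set (PeriodicDistrib n) :=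
  {T | ∃ g : SmoothPeriodic n, integralCube g = 0 ∧ T = ofSmooth g}

/-- The lattice points `ξ ∈ ℤⁿ` with `|ξ| ≤ m` (Euclidean norm). -/
def latticeBall (n m : ℕ) : Finset (Fin n → ℤ) :=
  (Finset.Icc (fun _ => -(m : ℤ)) (fun _ => (m : ℤ))).filter fun ξ => ∑ j, ξ j ^ 2 ≤ (m : ℤ) ^ 2

/-- The partial sum `T_m = ∑_{|ξ| ≤ m} \hat T(ξ) e_ξ` of the Fourier series of `T`. -/
def partialSum {n : ℕ} (m : ℕ) (T : PeriodicDistrib n) : SmoothPeriodic n :=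
  ∑ ξ ∈ latticeBall n m, fourierCoeffD T ξ • expo ξ

/-- The `k`-th component of `(v·∇)v = ∑_j v_j ∂_j v` for a smooth periodic field `v`. -/
def convectionSmooth {n : ℕ} (v : Fin n → SmoothPeriodic n) (k : Fin n) : SmoothPeriodic n :=
  ∑ j, v j * partialSmooth j (v k)

/-- `b = (u·∇)u` in the sense of distributions: `(u_m·∇)u_m → b` in `D'_#`, where `u_m` are the
partial sums of the Fourier series of `u`. -/
def IsConvection {n : ℕ} (u b : Fin n → PeriodicDistrib n) : Prop :=
  ∀ (k : Fin n) (φ : SmoothPeriodic n),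
    Tendsto (fun m : ℕ => pair (ofSmooth (convectionSmooth (fun j => partialSum m (u j)) k)) φ)
      atTop (𝓝 (pair (b k) φ))

/-- The symmetry conditions `a_{kj}^{αβ} = a_{αj}^{kβ} = a_{kβ}^{αj}` of the viscosity tensor;
`a k j α β` stands for `a_{kj}^{αβ}`. -/
def TensorSymmetric {n : ℕ} (a : Fin n → Fin n → Fin n → Fin n → ℝ) : Prop :=
  ∀ k j α β, a k j α β = a α j k β ∧ a k j α β = a k β α j

/-- The relaxed ellipticity condition, on symmetric real matrices of zero trace. -/
def RelaxedElliptic {n : ℕ} (a : Fin n → Fin n → Fin n → Fin n → ℝ) : Prop :=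
  ∃ C : ℝ, 0 < C ∧ ∀ ζ : Matrix (Fin n) (Fin n) ℝ, ζ.transpose = ζ → ζ.trace = 0 →
    C⁻¹ * ∑ k, ∑ α, ζ k α ^ 2 ≤ ∑ k, ∑ j, ∑ α, ∑ β, a k j α β * ζ k α * ζ j β

/-- The entries `E_{jβ}(u) = (∂_j u_β + ∂_β u_j) / 2` of the symmetric gradient. -/
def strain {n : ℕ} (u : Fin n → PeriodicDistrib n) (j β : Fin n) : PeriodicDistrib n :=
  (1 / 2 : ℂ) • (partialD j (u β) + partialD β (u j))

/-- The components `∂_α (a_{kj}^{αβ} E_{jβ}(u))` of the anisotropic viscosity operator. -/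
def viscous {n : ℕ} (a : Fin n → Fin n → Fin n → Fin n → ℝ) (u : Fin n → PeriodicDistrib n)
    (k : Fin n) : PeriodicDistrib n :=
  ∑ α, partialD α (∑ j, ∑ β, (a k j α β : ℂ) • strain u j β)

/-- The anisotropic Stokes operator `L(u,p) = viscous a u - ∇p`. -/
def stokes {n : ℕ} (a : Fin n → Fin n → Fin n → Fin n → ℝ) (u : Fin n → PeriodicDistrib n)
    (p : PeriodicDistrib n) (k : Fin n) : PeriodicDistrib n :=
  viscous a u k - partialD k p

/-- `(u,p)` satisfies `-L(u,p) = f - (u·∇)u` in the sense of distributions. -/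
def SolvesNavierStokes {n : ℕ} (a : Fin n → Fin n → Fin n → Fin n → ℝ) (u : Fin n → PeriodicDistrib n)
    (p : PeriodicDistrib n) (f : Fin n → PeriodicDistrib n) : Prop :=
  ∃ b : Fin n → PeriodicDistrib n, IsConvection u b ∧ ∀ k, -stokes a u p k = f k - b k

end PeriodicNS

end

open PeriodicNS

/-! Everything is read off the Fourier coefficients. At a frequency `ξ ≠ 0` the linear part is an
algebraic system for `û(ξ)` and `p̂(ξ)`. Incompressibility says `ξ · û(ξ) = 0`, so the symmetrised
product of `ξ` and `û(ξ)` is trace free and relaxed ellipticity applies to it. Pairing the system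
with the conjugate of `û(ξ)` removes the pressure, which is afterwards recovered from the equation
(`stokes_symbol_estimate`). In the convection term incompressibility moves the derivative outside
the product, so its coefficients are at most a constant times `ρ (U * U)`, where `U = ∑ |û_j|`
(`enorm_fourierCoeffD_le_of_isConvection`). Together these give `ρ² U ≤ A (Φ + ρ (U * U))` with `Φ =
∑ |f̂_j|`, and the same bound for `ρ |p̂|`.

What remains concerns nonnegative sequences in weighted `ℓ²`. If `U ∈ H^s`, then `U * U ∈ H^{s-a}`
as soon as `a + b > n/2` for some `b ∈ [0, s]` (`sobolevSq_conv_self_lt_top`). Since `s₁ > n/2 - 1`,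
one may take `b = s₁` and `a = 1 - ε`. Inverting the second-order operator gains 2 orders and the
nonlinearity costs `1 + a = 2 - ε`, so each pass gains `ε`, and finitely many passes reach `s₂`
(`sobolevSq_bootstrap`).

For smooth data this holds for every exponent. The coefficients then decay rapidly, their Fourier
series is a smooth function, and it represents the distribution because a periodic distribution is
determined by its coefficients (`eq_of_fourierCoeffD_eq`). -/

namespace PeriodicNS

open scoped ENNReal

/-! ### Weighted `ℓ²` sequences on the lattice, convolution estimates and the bootstrap -/

section Sequences

variable {n : ℕ}

lemma one_le_rho (ξ : Fin n → ℤ) : 1 ≤ rho ξ :=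
  Real.one_le_sqrt.2 (le_add_of_nonneg_right (Finset.sum_nonneg fun _ _ => sq_nonneg _))

lemma rho_pos (ξ : Fin n → ℤ) : 0 < rho ξ := zero_lt_one.trans_le (one_le_rho ξ)

lemma rho_sq (ξ : Fin n → ℤ) : rho ξ ^ 2 = 1 + ∑ j, (ξ j : ℝ) ^ 2 :=
  Real.sq_sqrt (add_nonneg zero_le_one (Finset.sum_nonneg fun _ _ => sq_nonneg _))

lemma abs_le_rho (ξ : Fin n → ℤ) (j : Fin n) : |(ξ j : ℝ)| ≤ rho ξ := by
  refine abs_le_of_sq_le_sq ?_ (rho_pos ξ).le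
  rw [rho_sq]
  have := Finset.single_le_sum (f := fun j => (ξ j : ℝ) ^ 2) (fun _ _ => sq_nonneg _)
    (Finset.mem_univ j)
  linarith

lemma rho_add_le (η ζ : Fin n → ℤ) : rho (η + ζ) ≤ 2 * max (rho η) (rho ζ) := by
  have h : rho (η + ζ) ^ 2 ≤ 2 * rho η ^ 2 + 2 * rho ζ ^ 2 := by
    simp only [rho_sq, Pi.add_apply, Int.cast_add]
    have : ∑ j, ((η j : ℝ) + ζ j) ^ 2 ≤ ∑ j, (2 * (η j : ℝ) ^ 2 + 2 * (ζ j : ℝ) ^ 2) :=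
      Finset.sum_le_sum fun j _ => by nlinarith [sq_nonneg ((η j : ℝ) - ζ j)]
    rw [Finset.sum_add_distrib, ← Finset.mul_sum, ← Finset.mul_sum] at this
    linarith
  have h1 : rho η ^ 2 ≤ max (rho η) (rho ζ) ^ 2 :=
    pow_le_pow_left₀ (rho_pos η).le (le_max_left _ _) 2
  have h2 : rho ζ ^ 2 ≤ max (rho η) (rho ζ) ^ 2 :=
    pow_le_pow_left₀ (rho_pos ζ).le (le_max_right _ _) 2
  refine le_of_sq_le_sq ?_ (by have := rho_pos η; positivity)
  nlinarith

/-- The weight dominates the sup norm and `r < 0`, so this follows by comparison with the known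
lattice sum of `‖ξ‖ ^ r`. -/
lemma summable_rho_rpow {r : ℝ} (hr : r < -(n : ℝ)) :
    Summable fun ξ : Fin n → ℤ => rho ξ ^ r := by
  have hr0 : r < 0 := hr.trans_le (by simp)
  let b := Pi.basisFun ℝ (Fin n)
  let Λ : Submodule ℤ (Fin n → ℝ) := Submodule.span ℤ (Set.range b)
  have hrank : Module.finrank ℤ Λ = n := by
    rw [ZLattice.rank ℝ Λ]; simp
  have hs := ZLattice.summable_norm_rpow Λ r (by rw [hrank]; exact hr)
  have hmem : ∀ ξ : Fin n → ℤ, (fun j => (ξ j : ℝ)) ∈ Λ := fun ξ => by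
    have : (fun j => (ξ j : ℝ)) = ∑ j, ξ j • b j := by
      ext i
      simp [b, Finset.sum_apply, Pi.single_apply]
    rw [this]
    exact Submodule.sum_mem _ fun j _ =>
      Submodule.smul_mem _ _ (Submodule.subset_span (Set.mem_range_self j))
  let ι : (Fin n → ℤ) → Λ := fun ξ => ⟨fun j => (ξ j : ℝ), hmem ξ⟩
  have hι : Function.Injective ι := fun ξ η h => by
    ext j
    have := congrFun (congrArg Subtype.val h) j
    exact Int.cast_injective (α := ℝ) this
  have hs' := hs.comp_injective hι
  refine Summable.of_norm_bounded_eventually hs' ?_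
  -- The comparison fails only at the origin, where `0 ^ r = 0` by convention while `ρ = 1`.
  have : ∀ᶠ ξ : Fin n → ℤ in cofinite, ξ ≠ 0 := by
    simp [Filter.eventually_cofinite]
  filter_upwards [this] with ξ hξ
  rw [Real.norm_of_nonneg (Real.rpow_nonneg (rho_pos ξ).le _)]
  refine Real.rpow_le_rpow_of_nonpos ?_ ?_ hr0.le
  · rw [norm_pos_iff]
    intro h
    exact hξ (hι (h.trans (by ext j; simp [ι])))
  · change ‖fun j => (ξ j : ℝ)‖ ≤ _
    rw [pi_norm_le_iff_of_nonneg (rho_pos ξ).le]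
    exact fun j => abs_le_rho ξ j

/-- The weight `ρ(ξ)` as an extended nonnegative real. -/
noncomputable def weight (ξ : Fin n → ℤ) : ℝ≥0∞ := ENNReal.ofReal (rho ξ)

lemma weight_ne_zero (ξ : Fin n → ℤ) : weight ξ ≠ 0 := by
  simp [weight, rho_pos ξ]

lemma weight_ne_top (ξ : Fin n → ℤ) : weight ξ ≠ ⊤ := ENNReal.ofReal_ne_top

lemma one_le_weight (ξ : Fin n → ℤ) : 1 ≤ weight ξ := by
  simpa [weight] using one_le_rho ξ

lemma weight_rpow_add (ξ : Fin n → ℤ) (s t : ℝ) :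
    weight ξ ^ (s + t) = weight ξ ^ s * weight ξ ^ t :=
  ENNReal.rpow_add _ _ (weight_ne_zero ξ) (weight_ne_top ξ)

lemma weight_add_rpow_le (η ζ : Fin n → ℤ) {s : ℝ} (hs : 0 ≤ s) :
    weight (η + ζ) ^ s ≤ 2 ^ s * (weight η ^ s + weight ζ ^ s) := by
  have h : weight (η + ζ) ≤ 2 * max (weight η) (weight ζ) := by
    refine (ENNReal.ofReal_le_ofReal (rho_add_le η ζ)).trans_eq ?_
    rw [ENNReal.ofReal_mul zero_le_two]
    simp [weight, ENNReal.ofReal_max]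
  calc weight (η + ζ) ^ s ≤ (2 * max (weight η) (weight ζ)) ^ s := ENNReal.rpow_le_rpow h hs
    _ = 2 ^ s * (max (weight η) (weight ζ)) ^ s := ENNReal.mul_rpow_of_nonneg _ _ hs
    _ ≤ _ := by
      gcongr
      rcases le_total (weight η) (weight ζ) with h | h
      · rw [max_eq_right h]; exact le_add_self
      · rw [max_eq_left h]; exact le_self_add

lemma tsum_weight_rpow_lt_top {r : ℝ} (hr : r < -(n : ℝ)) :
    ∑' ξ : Fin n → ℤ, weight ξ ^ r < ⊤ := by
  have h := (summable_rho_rpow hr).tsum_ofReal_lt_top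
  simpa only [weight, ENNReal.ofReal_rpow_of_pos (rho_pos _)] using h

lemma weight_rpow_neg_anti {ξ η : Fin n → ℤ} (h : weight ξ ≤ weight η) {b : ℝ} (hb : 0 ≤ b) :
    weight η ^ (-b) ≤ weight ξ ^ (-b) := by
  rw [ENNReal.rpow_neg, ENNReal.rpow_neg, ENNReal.inv_le_inv]
  exact ENNReal.rpow_le_rpow h hb

/-- Replacing the larger weight by the smaller one only increases a negative power. -/
lemma weight_rpow_neg_mul_le (ξ η : Fin n → ℤ) {a b : ℝ} (ha : 0 ≤ a) (hb : 0 ≤ b) :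
    weight ξ ^ (-a) * weight η ^ (-b) ≤ weight ξ ^ (-(a + b)) + weight η ^ (-(a + b)) := by
  rcases le_total (weight ξ) (weight η) with h | h
  · refine le_trans ?_ le_self_add
    rw [neg_add, weight_rpow_add]
    exact mul_le_mul_right (weight_rpow_neg_anti h hb) _
  · refine le_trans ?_ le_add_self
    rw [neg_add, weight_rpow_add]
    gcongr ?_ * _
    exact weight_rpow_neg_anti h ha

/-- Cauchy–Schwarz, as Hölder's inequality for counting measure. -/
lemma tsum_mul_sq_le {ι : Type*} (f g : ι → ℝ≥0∞) :
    (∑' i, f i * g i) ^ 2 ≤ (∑' i, f i ^ 2) * ∑' i, g i ^ 2 := by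
  let _ : MeasurableSpace ι := ⊤
  have h := ENNReal.lintegral_mul_le_Lp_mul_Lq (Measure.count : Measure ι)
    (p := 2) (q := 2) Real.HolderConjugate.two_two
    (f := f) (g := g) measurable_from_top.aemeasurable measurable_from_top.aemeasurable
  simp only [lintegral_count, Pi.mul_apply] at h
  calc (∑' i, f i * g i) ^ 2 ≤ _ := pow_le_pow_left₀ zero_le h 2
    _ = _ := by
      rw [mul_pow, ← ENNReal.rpow_natCast, ← ENNReal.rpow_natCast, ← ENNReal.rpow_mul,
        ← ENNReal.rpow_mul]
      norm_num

lemma add_sq_le_two_mul (x y : ℝ≥0∞) : (x + y) ^ 2 ≤ 2 * (x ^ 2 + y ^ 2) := by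
  have := ENNReal.rpow_add_le_mul_rpow_add_rpow x y (p := 2) (by norm_num)
  norm_num at this
  exact this

lemma tsum_sum_sq_lt_top {ι κ : Type*} (s : Finset κ) (f : κ → ι → ℝ≥0∞)
    (h : ∀ k ∈ s, ∑' i, f k i ^ 2 < ⊤) : ∑' i, (∑ k ∈ s, f k i) ^ 2 < ⊤ := by
  classical
  induction s using Finset.induction_on with
  | empty => simp
  | insert k s hk ih =>
    simp only [Finset.sum_insert hk]
    calc ∑' i, (f k i + ∑ k ∈ s, f k i) ^ 2
        ≤ ∑' i, 2 * (f k i ^ 2 + (∑ k ∈ s, f k i) ^ 2) :=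
          ENNReal.tsum_le_tsum fun i => add_sq_le_two_mul _ _
      _ = 2 * (∑' i, f k i ^ 2 + ∑' i, (∑ k ∈ s, f k i) ^ 2) := by
          rw [ENNReal.tsum_mul_left, ENNReal.tsum_add]
      _ < ⊤ := ENNReal.mul_lt_top (by simp) (ENNReal.add_lt_top.2
          ⟨h k (Finset.mem_insert_self _ _), ih fun j hj => h j (Finset.mem_insert_of_mem hj)⟩)

/-- Convolution of nonnegative functions on `ℤⁿ`. -/
noncomputable def conv (G K : (Fin n → ℤ) → ℝ≥0∞) (ξ : Fin n → ℤ) : ℝ≥0∞ :=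
  ∑' η, G (ξ - η) * K η

lemma conv_comm (G K : (Fin n → ℤ) → ℝ≥0∞) : conv G K = conv K G := by
  ext ξ
  rw [conv, ← (Equiv.subLeft ξ).tsum_eq]
  exact tsum_congr fun η => by simp [mul_comm]

lemma tsum_comp_sub_left (ξ : Fin n → ℤ) (f : (Fin n → ℤ) → ℝ≥0∞) :
    ∑' η, f (ξ - η) = ∑' η, f η :=
  (Equiv.subLeft ξ).tsum_eq f

lemma conv_sq_le (G K : (Fin n → ℤ) → ℝ≥0∞) (ξ : Fin n → ℤ) :
    conv G K ξ ^ 2 ≤ (∑' η, G η ^ 2) * ∑' η, K η ^ 2 := by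
  refine (tsum_mul_sq_le _ _).trans_eq ?_
  rw [tsum_comp_sub_left ξ fun η => G η ^ 2]

/-- Young's inequality `ℓ² * ℓ¹ ⊆ ℓ²`. -/
lemma tsum_conv_sq_le (G K : (Fin n → ℤ) → ℝ≥0∞) :
    ∑' ξ, conv G K ξ ^ 2 ≤ (∑' η, G η ^ 2) * (∑' η, K η) ^ 2 := by
  have hK : ∀ x : ℝ≥0∞, x ^ (1 / 2 : ℝ) * x ^ (1 / 2 : ℝ) = x := fun x => by
    rw [← ENNReal.rpow_add_of_nonneg _ _ (by norm_num) (by norm_num)]; norm_num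
  -- Cauchy–Schwarz after splitting `K` into two square roots.
  have h : ∀ ξ, conv G K ξ ^ 2 ≤ (∑' η, G (ξ - η) ^ 2 * K η) * ∑' η, K η := fun ξ => by
    have := tsum_mul_sq_le (fun η => G (ξ - η) * K η ^ (1 / 2 : ℝ)) (fun η => K η ^ (1 / 2 : ℝ))
    simpa only [conv, mul_assoc, hK, mul_pow, sq (_ ^ (1 / 2 : ℝ))] using this
  calc ∑' ξ, conv G K ξ ^ 2 ≤ ∑' ξ, (∑' η, G (ξ - η) ^ 2 * K η) * ∑' η, K η :=
        ENNReal.tsum_le_tsum h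
    _ = (∑' η, ∑' ξ, G (ξ - η) ^ 2 * K η) * ∑' η, K η := by
        rw [ENNReal.tsum_mul_right, ENNReal.tsum_comm]
    _ = _ := by
        have : ∀ η, ∑' ξ, G (ξ - η) ^ 2 * K η = (∑' ξ, G ξ ^ 2) * K η := fun η => by
          rw [ENNReal.tsum_mul_right]
          congr 1
          exact (Equiv.subRight η).tsum_eq fun ξ => G ξ ^ 2
        simp only [this, ENNReal.tsum_mul_left]
        ring

/-- The square of the `H^s` norm of a coefficient sequence. -/
noncomputable def sobolevSq (s : ℝ) (U : (Fin n → ℤ) → ℝ≥0∞) : ℝ≥0∞ :=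
  ∑' ξ, (weight ξ ^ s * U ξ) ^ 2

lemma sobolevSq_mono {s : ℝ} {U V : (Fin n → ℤ) → ℝ≥0∞} (h : ∀ ξ, U ξ ≤ V ξ) :
    sobolevSq s U ≤ sobolevSq s V :=
  ENNReal.tsum_le_tsum fun ξ => by gcongr; exact h ξ

lemma sobolevSq_mono_exponent {s t : ℝ} (hst : s ≤ t) (U : (Fin n → ℤ) → ℝ≥0∞) :
    sobolevSq s U ≤ sobolevSq t U :=
  ENNReal.tsum_le_tsum fun ξ => by gcongr; exact one_le_weight ξ

lemma sobolevSq_sum_lt_top {κ : Type*} (t : Finset κ) {s : ℝ} (U : κ → (Fin n → ℤ) → ℝ≥0∞)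
    (h : ∀ k ∈ t, sobolevSq s (U k) < ⊤) : sobolevSq s (fun ξ => ∑ k ∈ t, U k ξ) < ⊤ := by
  simp only [sobolevSq, Finset.mul_sum]
  exact tsum_sum_sq_lt_top t _ h

lemma sobolevSq_add_lt_top {s : ℝ} {U V : (Fin n → ℤ) → ℝ≥0∞} (hU : sobolevSq s U < ⊤)
    (hV : sobolevSq s V < ⊤) : sobolevSq s (fun ξ => U ξ + V ξ) < ⊤ := by
  have := sobolevSq_sum_lt_top Finset.univ (s := s) (fun b : Bool => if b then U else V)
    (by simp [hU, hV])
  simpa using this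

lemma sobolevSq_const_mul_lt_top {s : ℝ} {U : (Fin n → ℤ) → ℝ≥0∞} {A : ℝ≥0∞} (hA : A ≠ ⊤)
    (hU : sobolevSq s U < ⊤) : sobolevSq s (fun ξ => A * U ξ) < ⊤ := by
  have : sobolevSq s (fun ξ => A * U ξ) = A ^ 2 * sobolevSq s U := by
    rw [sobolevSq, sobolevSq, ← ENNReal.tsum_mul_left]
    exact tsum_congr fun ξ => by ring
  rw [this]
  exact ENNReal.mul_lt_top (ENNReal.pow_lt_top hA.lt_top) hU

lemma sobolevSq_weight_rpow_mul (s t : ℝ) (U : (Fin n → ℤ) → ℝ≥0∞) :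
    sobolevSq s (fun ξ => weight ξ ^ t * U ξ) = sobolevSq (s + t) U :=
  tsum_congr fun ξ => by rw [weight_rpow_add, mul_assoc]

lemma sobolevSq_weight_mul (s : ℝ) (U : (Fin n → ℤ) → ℝ≥0∞) :
    sobolevSq s (fun ξ => weight ξ * U ξ) = sobolevSq (s + 1) U := by
  simpa using sobolevSq_weight_rpow_mul s 1 U

/-- If `a, b ≥ 0` and `a + b > n/2`, then `H⁰ · H^b ⊆ H^{-a}`. -/
lemma sobolevSq_conv_lt_top {a b : ℝ} (ha : 0 ≤ a) (hb : 0 ≤ b) (hab : (n : ℝ) / 2 < a + b)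
    {G V : (Fin n → ℤ) → ℝ≥0∞} (hG : sobolevSq 0 G < ⊤) (hV : sobolevSq b V < ⊤) :
    sobolevSq (-a) (conv G V) < ⊤ := by
  set W : (Fin n → ℤ) → ℝ≥0∞ := fun ξ => weight ξ ^ b * V ξ with hW
  have hG' : ∑' ξ, G ξ ^ 2 < ⊤ := by simpa [sobolevSq] using hG
  have hW' : ∑' ξ, W ξ ^ 2 < ⊤ := hV
  have hVW : ∀ ξ, V ξ = weight ξ ^ (-b) * W ξ := fun ξ => by
    rw [hW]
    simp only
    rw [← mul_assoc, ← weight_rpow_add]; simp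
  have hR : ∑' ξ : Fin n → ℤ, (weight ξ ^ (-(a + b))) ^ 2 < ⊤ := by
    have := tsum_weight_rpow_lt_top (n := n) (r := -(a + b) * 2) (by linarith)
    simpa only [ENNReal.rpow_mul, ENNReal.rpow_two] using this
  -- The first term is an `ℓ²` weight times a bounded convolution of `ℓ²` sequences. The second is
  -- `ℓ² * ℓ¹`, its `ℓ¹` factor coming from Cauchy–Schwarz. Both use that `ρ ^ (-(a + b))` is in
  -- `ℓ²`, that is, `a + b > n/2`.
  have hpt : ∀ ξ, weight ξ ^ (-a) * conv G V ξ ≤ weight ξ ^ (-(a + b)) * conv G W ξ +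
      conv G (fun η => weight η ^ (-(a + b)) * W η) ξ := fun ξ => by
    simp only [conv]
    rw [← ENNReal.tsum_mul_left, ← ENNReal.tsum_mul_left, ← ENNReal.tsum_add]
    refine ENNReal.tsum_le_tsum fun η => ?_
    calc weight ξ ^ (-a) * (G (ξ - η) * V η)
        = (weight ξ ^ (-a) * weight η ^ (-b)) * (G (ξ - η) * W η) := by rw [hVW]; ring
      _ ≤ (weight ξ ^ (-(a + b)) + weight η ^ (-(a + b))) * (G (ξ - η) * W η) := by
        gcongr
        exact weight_rpow_neg_mul_le ξ η ha hb
      _ = _ := by ring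
  have hfin : (∑' ξ, (weight ξ ^ (-(a + b)) * conv G W ξ) ^ 2) +
      ∑' ξ, conv G (fun η => weight η ^ (-(a + b)) * W η) ξ ^ 2 < ⊤ := by
    refine ENNReal.add_lt_top.2 ⟨?_, ?_⟩
    · calc ∑' ξ, (weight ξ ^ (-(a + b)) * conv G W ξ) ^ 2
          ≤ ∑' ξ, (weight ξ ^ (-(a + b))) ^ 2 * ((∑' η, G η ^ 2) * ∑' η, W η ^ 2) :=
            ENNReal.tsum_le_tsum fun ξ => by
              rw [mul_pow]; gcongr; exact conv_sq_le G W ξ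
        _ < ⊤ := by
            rw [ENNReal.tsum_mul_right]
            exact ENNReal.mul_lt_top hR (ENNReal.mul_lt_top hG' hW')
    · refine (tsum_conv_sq_le _ _).trans_lt (ENNReal.mul_lt_top hG' (ENNReal.pow_lt_top ?_))
      have h := (tsum_mul_sq_le (fun η => weight η ^ (-(a + b))) W).trans_lt
        (ENNReal.mul_lt_top hR hW')
      by_contra hcon
      rw [not_lt, top_le_iff] at hcon
      rw [hcon] at h
      simp at h
  calc sobolevSq (-a) (conv G V)
      ≤ ∑' ξ, 2 * ((weight ξ ^ (-(a + b)) * conv G W ξ) ^ 2 +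
        conv G (fun η => weight η ^ (-(a + b)) * W η) ξ ^ 2) :=
        ENNReal.tsum_le_tsum fun ξ =>
          (pow_le_pow_left₀ zero_le (hpt ξ) 2).trans (add_sq_le_two_mul _ _)
    _ < ⊤ := by
        rw [ENNReal.tsum_mul_left, ENNReal.tsum_add]
        exact ENNReal.mul_lt_top (by simp) hfin

/-- The quadratic product estimate: `U ∈ H^s` implies `U * U ∈ H^{s-a}` when `0 ≤ a`,
`0 ≤ b ≤ s` and `a + b > n/2`. -/
lemma sobolevSq_conv_self_lt_top {a b s : ℝ} (ha : 0 ≤ a) (hb : 0 ≤ b) (hbs : b ≤ s)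
    (hab : (n : ℝ) / 2 < a + b) {U : (Fin n → ℤ) → ℝ≥0∞} (hU : sobolevSq s U < ⊤) :
    sobolevSq (s - a) (conv U U) < ⊤ := by
  set G : (Fin n → ℤ) → ℝ≥0∞ := fun ξ => weight ξ ^ s * U ξ with hGdef
  have hG : sobolevSq 0 G < ⊤ := by
    rw [hGdef, sobolevSq_weight_rpow_mul, zero_add]; exact hU
  have hU' : sobolevSq b U < ⊤ := (sobolevSq_mono_exponent hbs U).trans_lt hU
  -- The weight `ρ(ξ)^s` falls on one factor or the other, and the two cases agree by commutativity
  -- of convolution.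
  have hpt : ∀ ξ, weight ξ ^ s * conv U U ξ ≤ 2 ^ s * 2 * conv G U ξ := fun ξ => by
    have h1 : weight ξ ^ s * conv U U ξ ≤ 2 ^ s * (conv G U ξ + conv U G ξ) := by
      simp only [conv]
      rw [← ENNReal.tsum_mul_left, ← ENNReal.tsum_add, ← ENNReal.tsum_mul_left]
      refine ENNReal.tsum_le_tsum fun η => ?_
      have := weight_add_rpow_le (ξ - η) η (hb.trans hbs)
      rw [sub_add_cancel] at this
      calc weight ξ ^ s * (U (ξ - η) * U η)
          ≤ (2 ^ s * (weight (ξ - η) ^ s + weight η ^ s)) * (U (ξ - η) * U η) := by gcongr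
        _ = _ := by simp only [hGdef]; ring
    rw [conv_comm U G] at h1
    exact h1.trans_eq (by ring)
  have h2 := sobolevSq_const_mul_lt_top (A := 2 ^ s * 2) (ENNReal.mul_ne_top
    (ENNReal.rpow_ne_top_of_nonneg (hb.trans hbs) (by simp)) (by simp))
    (sobolevSq_conv_lt_top ha hb hab hG hU')
  rw [sub_eq_neg_add, ← sobolevSq_weight_rpow_mul]
  exact (sobolevSq_mono hpt).trans_lt h2

/-- Bootstrapping for the quadratic elliptic inequality `ρ² U ≲ Φ + ρ (U * U)` satisfied by the
Fourier coefficients of a solution. -/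
lemma sobolevSq_bootstrap {s₁ s₂ : ℝ} (hn : 2 ≤ n) (hs₁ : -1 + (n : ℝ) / 2 < s₁) (hs₂ : s₁ < s₂)
    {U Φ : (Fin n → ℤ) → ℝ≥0∞} {A : ℝ≥0∞} (hA : A ≠ ⊤)
    (h : ∀ ξ, weight ξ ^ (2 : ℝ) * U ξ ≤ A * (Φ ξ + weight ξ * conv U U ξ))
    (hU : sobolevSq s₁ U < ⊤) (hΦ : sobolevSq (s₂ - 2) Φ < ⊤) :
    sobolevSq s₂ U < ⊤ ∧ sobolevSq (s₂ - 2) (fun ξ => Φ ξ + weight ξ * conv U U ξ) < ⊤ := by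
  have hn' : (2 : ℝ) ≤ n := by exact_mod_cast hn
  -- The bound `ε ≤ 1` keeps `a = 1 - ε` nonnegative. The other bound leaves `a + s₁ > n/2` with
  -- room to spare.
  set ε : ℝ := min 1 ((s₁ + 1 - n / 2) / 2) with hε
  have hε0 : 0 < ε := lt_min one_pos (by linarith)
  have hε1 : ε ≤ 1 := min_le_left _ _
  have hε2 : ε ≤ (s₁ + 1 - n / 2) / 2 := min_le_right _ _
  have hrhs : ∀ s, s₁ ≤ s → sobolevSq s U < ⊤ → ∀ t, t ≤ s + ε → t ≤ s₂ →
      sobolevSq (t - 2) (fun ξ => Φ ξ + weight ξ * conv U U ξ) < ⊤ := by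
    intro s hs hsU t ht1 ht2
    refine sobolevSq_add_lt_top
      ((sobolevSq_mono_exponent (by linarith) Φ).trans_lt hΦ) ?_
    rw [sobolevSq_weight_mul]
    refine (sobolevSq_mono_exponent (t := s - (1 - ε)) (by linarith) _).trans_lt ?_
    -- Here `n ≥ 2` enters: it makes `b = s₁ > n/2 - 1` nonnegative.
    exact sobolevSq_conv_self_lt_top (b := s₁) (by linarith) (by linarith) hs (by linarith) hsU
  have hstep : ∀ s, s₁ ≤ s → sobolevSq s U < ⊤ → ∀ t, t ≤ s + ε → t ≤ s₂ →
      sobolevSq t U < ⊤ := by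
    intro s hs hsU t ht1 ht2
    have h1 := sobolevSq_const_mul_lt_top hA (hrhs s hs hsU t ht1 ht2)
    have h2 := (sobolevSq_mono h).trans_lt h1
    rwa [sobolevSq_weight_rpow_mul, sub_add_cancel] at h2
  -- The exponent is capped at `s₂`, since `Φ` is controlled no further.
  have hiter : ∀ k : ℕ, sobolevSq (min s₂ (s₁ + k * ε)) U < ⊤ := by
    intro k
    induction k with
    | zero => simpa [hs₂.le] using hU
    | succ k ih =>
      refine hstep _ (le_min hs₂.le (by simp; positivity)) ih _ ?_ (min_le_left _ _)
      rw [← min_add_add_right]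
      exact min_le_min (by linarith) (by push_cast; linarith)
  obtain ⟨k, hk⟩ := exists_nat_ge ((s₂ - s₁) / ε)
  have hfin : sobolevSq s₂ U < ⊤ := by
    have := hiter k
    rwa [min_eq_left] at this
    rw [div_le_iff₀ hε0] at hk
    linarith
  exact ⟨hfin, hrhs s₂ hs₂.le hfin s₂ (by linarith) le_rfl⟩

end Sequences

/-! ### Exponentials, integration over the torus and Fourier coefficients -/

section Calculus

variable {n : ℕ}

lemma expo_apply (ξ : Fin n → ℤ) (x : Fin n → ℝ) :
    (expo ξ : (Fin n → ℝ) → ℂ) x =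
      Complex.exp (2 * Real.pi * Complex.I * ((∑ j, x j * (ξ j : ℝ) : ℝ) : ℂ)) := rfl

lemma expo_zero : expo (0 : Fin n → ℤ) = 1 := by
  ext x
  simp [expo_apply]

lemma expo_add (ξ η : Fin n → ℤ) : expo (ξ + η) = expo ξ * expo η := by
  ext x
  change (expo (ξ + η) : (Fin n → ℝ) → ℂ) x =
    (expo ξ : (Fin n → ℝ) → ℂ) x * (expo η : (Fin n → ℝ) → ℂ) x
  rw [expo_apply, expo_apply, expo_apply, ← Complex.exp_add]
  congr 1
  simp only [Pi.add_apply, Int.cast_add, mul_add, Finset.sum_add_distrib]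
  push_cast
  ring

lemma norm_expo_apply (ξ : Fin n → ℤ) (x : Fin n → ℝ) :
    ‖(expo ξ : (Fin n → ℝ) → ℂ) x‖ = 1 := by
  rw [expo_apply]
  have : (2 * Real.pi * Complex.I * ((∑ j, x j * (ξ j : ℝ) : ℝ) : ℂ)) =
      ((2 * Real.pi * ∑ j, x j * (ξ j : ℝ) : ℝ) : ℂ) * Complex.I := by push_cast; ring
  rw [this, Complex.norm_exp_ofReal_mul_I]

/-- The linear form `x ↦ 2πi x·ξ`. -/
noncomputable def phase (ξ : Fin n → ℤ) : (Fin n → ℝ) →L[ℝ] ℂ :=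
  (2 * Real.pi * Complex.I : ℂ) • (Complex.ofRealCLM.comp
    (∑ j, (ξ j : ℝ) • ContinuousLinearMap.proj (R := ℝ) (φ := fun _ : Fin n => ℝ) j))

lemma phase_apply (ξ : Fin n → ℤ) (x : Fin n → ℝ) :
    phase ξ x = 2 * Real.pi * Complex.I * ((∑ j, x j * (ξ j : ℝ) : ℝ) : ℂ) := by
  simp [phase, mul_comm]

lemma expo_eq_exp_phase (ξ : Fin n → ℤ) (x : Fin n → ℝ) :
    (expo ξ : (Fin n → ℝ) → ℂ) x = Complex.exp (phase ξ x) := by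
  rw [phase_apply, expo_apply]

lemma hasFDerivAt_expo (ξ : Fin n → ℤ) (x : Fin n → ℝ) :
    HasFDerivAt (expo ξ : (Fin n → ℝ) → ℂ) ((expo ξ : (Fin n → ℝ) → ℂ) x • phase ξ) x := by
  have h := (phase ξ).hasFDerivAt (x := x) |>.cexp
  have h2 : (expo ξ : (Fin n → ℝ) → ℂ) = fun x => Complex.exp (phase ξ x) :=
    funext (expo_eq_exp_phase ξ)
  rw [h2]
  exact h

lemma partialSmooth_expo (j : Fin n) (ξ : Fin n → ℤ) :
    partialSmooth j (expo ξ) = (2 * Real.pi * Complex.I * ξ j : ℂ) • expo ξ := by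
  ext x
  change fderiv ℝ (expo ξ : (Fin n → ℝ) → ℂ) x (Pi.single j 1) = _ * _
  rw [(hasFDerivAt_expo ξ x).fderiv]
  simp [phase_apply, Pi.single_apply, mul_comm]

lemma partialSmooth_mul (j : Fin n) (φ ψ : SmoothPeriodic n) :
    partialSmooth j (φ * ψ) = partialSmooth j φ * ψ + φ * partialSmooth j ψ := by
  ext x
  have hφ : DifferentiableAt ℝ (φ : (Fin n → ℝ) → ℂ) x := (φ.2.1.differentiable (by simp)) x
  have hψ : DifferentiableAt ℝ (ψ : (Fin n → ℝ) → ℂ) x := (ψ.2.1.differentiable (by simp)) x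
  change fderiv ℝ ((φ : (Fin n → ℝ) → ℂ) * (ψ : (Fin n → ℝ) → ℂ)) x (Pi.single j 1) =
    fderiv ℝ (φ : (Fin n → ℝ) → ℂ) x (Pi.single j 1) * (ψ : (Fin n → ℝ) → ℂ) x +
      (φ : (Fin n → ℝ) → ℂ) x * fderiv ℝ (ψ : (Fin n → ℝ) → ℂ) x (Pi.single j 1)
  rw [fderiv_mul hφ hψ]
  simp
  ring

lemma integralCube_eq_Icc (φ : SmoothPeriodic n) :
    integralCube φ = ∫ x in Set.Icc (0 : Fin n → ℝ) 1, (φ : (Fin n → ℝ) → ℂ) x := by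
  refine setIntegral_congr_set ?_
  exact Measure.univ_pi_Ico_ae_eq_Icc (f := fun _ => (0 : ℝ)) (g := fun _ => 1)

lemma periodic_add_single (φ : SmoothPeriodic n) (j : Fin n) (x : Fin n → ℝ) :
    (φ : (Fin n → ℝ) → ℂ) (x + Pi.single j 1) = (φ : (Fin n → ℝ) → ℂ) x := by
  rw [← φ.2.2 x (Pi.single j 1)]
  refine congrArg (φ : (Fin n → ℝ) → ℂ) (funext fun i => ?_)
  by_cases h : i = j
  · subst h; simp
  · simp [h]

/-- Divergence theorem on the unit cube for the field whose only nonzero component is the `j`-th,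
equal to `φ`; the two opposite faces cancel by periodicity. -/
lemma integralCube_partialSmooth (j : Fin n) (φ : SmoothPeriodic n) :
    integralCube (partialSmooth j φ) = 0 := by
  obtain _ | n := n
  · exact j.elim0
  rw [integralCube_eq_Icc]
  have hd : Differentiable ℝ (φ : (Fin (n + 1) → ℝ) → ℂ) := φ.2.1.differentiable (by simp)
  have key := integral_divergence_of_hasFDerivAt_off_countable' (E := ℂ)
    (0 : Fin (n + 1) → ℝ) 1 (fun _ => zero_le_one)
    (fun i => if i = j then (φ : (Fin (n + 1) → ℝ) → ℂ) else 0)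
    (fun i => if i = j then fderiv ℝ (φ : (Fin (n + 1) → ℝ) → ℂ) else 0) ∅ Set.countable_empty
    (fun i => by
      split_ifs
      · exact hd.continuous.continuousOn
      · exact continuousOn_const)
    (fun x _ i => by
      split_ifs
      · exact (hd x).hasFDerivAt
      · exact hasFDerivAt_const 0 x) ?_
  · have hl : ∀ x : Fin (n + 1) → ℝ, ∑ i, (if i = j then fderiv ℝ (φ : (Fin (n + 1) → ℝ) → ℂ) else 0)
        x (Pi.single i 1) = (partialSmooth j φ : (Fin (n + 1) → ℝ) → ℂ) x := fun x => by
      rw [Finset.sum_eq_single j (fun i _ hi => by simp [hi]) (by simp), if_pos rfl]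
      rfl
    simp only [hl] at key
    rw [key]
    refine Finset.sum_eq_zero fun i _ => ?_
    split_ifs with hij
    · rw [sub_eq_zero]
      refine integral_congr_ae (Eventually.of_forall fun x => ?_)
      change (φ : (Fin (n + 1) → ℝ) → ℂ) (i.insertNth 1 x) =
        (φ : (Fin (n + 1) → ℝ) → ℂ) (i.insertNth 0 x)
      rw [← periodic_add_single φ i (i.insertNth (0 : ℝ) x)]
      refine congrArg (φ : (Fin (n + 1) → ℝ) → ℂ) (funext fun k => ?_)
      rcases Fin.eq_self_or_eq_succAbove i k with rfl | ⟨k, rfl⟩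
      · simp
      · simp
    · simp
  · have hc : Continuous fun x : Fin (n + 1) → ℝ =>
        (partialSmooth j φ : (Fin (n + 1) → ℝ) → ℂ) x := (partialSmooth j φ).2.1.continuous
    refine (hc.integrableOn_Icc).congr_fun (fun x _ => ?_) measurableSet_Icc
    rw [Finset.sum_eq_single j (fun i _ hi => by simp [hi]) (by simp), if_pos rfl]
    rfl

lemma integralCube_one : integralCube (1 : SmoothPeriodic n) = 1 := by
  change ∫ x in Set.univ.pi (fun _ : Fin n => Set.Ico (0 : ℝ) 1), (1 : ℂ) = 1
  simp [Measure.real, Real.volume_pi_Ico]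

/-- If `ξ j ≠ 0`, the exponential is a nonzero multiple of its own `j`-th derivative, which
integrates to zero. -/
lemma integralCube_expo (ξ : Fin n → ℤ) : integralCube (expo ξ) = if ξ = 0 then 1 else 0 := by
  split_ifs with h
  · rw [h, expo_zero, integralCube_one]
  · obtain ⟨j, hj⟩ := Function.ne_iff.1 h
    have := integralCube_partialSmooth j (expo ξ)
    rw [partialSmooth_expo, map_smul, smul_eq_mul] at this
    refine (mul_eq_zero.1 this).resolve_left (mul_ne_zero Complex.two_pi_I_ne_zero ?_)
    exact_mod_cast hj

lemma pair_ofSmooth (g φ : SmoothPeriodic n) : pair (ofSmooth g) φ = integralCube (g * φ) := rfl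

lemma partialD_ofSmooth (j : Fin n) (g : SmoothPeriodic n) :
    partialD j (ofSmooth g) = ofSmooth (partialSmooth j g) := by
  ext φ
  change -integralCube (g * partialSmooth j φ) = integralCube (partialSmooth j g * φ)
  have := integralCube_partialSmooth j (g * φ)
  rw [partialSmooth_mul, map_add] at this
  exact (eq_neg_of_add_eq_zero_left this).symm

lemma fourierCoeffD_add (S T : PeriodicDistrib n) (ξ : Fin n → ℤ) :
    fourierCoeffD (S + T) ξ = fourierCoeffD S ξ + fourierCoeffD T ξ := rfl

lemma fourierCoeffD_sub (S T : PeriodicDistrib n) (ξ : Fin n → ℤ) :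
    fourierCoeffD (S - T) ξ = fourierCoeffD S ξ - fourierCoeffD T ξ := rfl

lemma fourierCoeffD_neg (T : PeriodicDistrib n) (ξ : Fin n → ℤ) :
    fourierCoeffD (-T) ξ = -fourierCoeffD T ξ := rfl

lemma fourierCoeffD_smul (c : ℂ) (T : PeriodicDistrib n) (ξ : Fin n → ℤ) :
    fourierCoeffD (c • T) ξ = c * fourierCoeffD T ξ := rfl

lemma fourierCoeffD_sum {κ : Type*} (s : Finset κ) (T : κ → PeriodicDistrib n) (ξ : Fin n → ℤ) :
    fourierCoeffD (∑ k ∈ s, T k) ξ = ∑ k ∈ s, fourierCoeffD (T k) ξ := by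
  classical
  induction s using Finset.induction_on with
  | empty => rfl
  | insert k s hk ih => rw [Finset.sum_insert hk, Finset.sum_insert hk, fourierCoeffD_add, ih]

lemma fourierCoeffD_partialD (j : Fin n) (T : PeriodicDistrib n) (ξ : Fin n → ℤ) :
    fourierCoeffD (partialD j T) ξ = 2 * Real.pi * Complex.I * ξ j * fourierCoeffD T ξ := by
  change -pair T (partialSmooth j (expo (-ξ))) = _
  rw [partialSmooth_expo]
  change -((T : Module.Dual ℂ (SmoothPeriodic n)) (_ • expo (-ξ))) = _
  rw [map_smul, smul_eq_mul]
  simp only [fourierCoeffD, pair, Pi.neg_apply]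
  push_cast
  ring

lemma fourierCoeffD_zero_eq (T : PeriodicDistrib n) : fourierCoeffD T 0 = pair T 1 := by
  rw [fourierCoeffD, neg_zero, expo_zero]

end Calculus

/-! ### The symbol of the Stokes operator and its ellipticity -/

section Symbol

variable {n : ℕ}

/-- The matrix `∑_{α,β} a_{kj}^{αβ} ξ_α ξ_β`, up to a constant the principal symbol of the
viscosity operator. -/
def viscousSymbol (a : Fin n → Fin n → Fin n → Fin n → ℝ) (ξ : Fin n → ℝ) (k j : Fin n) : ℝ :=
  ∑ α, ∑ β, a k j α β * (ξ α * ξ β)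

lemma sum_swap_first_third {ι M : Type*} [Fintype ι] [AddCommMonoid M] (f : ι → ι → ι → M) :
    ∑ k, ∑ j, ∑ α, f k j α = ∑ k, ∑ j, ∑ α, f α j k := by
  calc ∑ k, ∑ j, ∑ α, f k j α = ∑ k, ∑ α, ∑ j, f k j α :=
        Finset.sum_congr rfl fun k _ => Finset.sum_comm
    _ = ∑ α, ∑ k, ∑ j, f k j α := Finset.sum_comm
    _ = ∑ α, ∑ j, ∑ k, f k j α := Finset.sum_congr rfl fun k _ => Finset.sum_comm

/-- The tensor is symmetric under `k ↔ α` and under `j ↔ β`, so the two halves of each symmetrised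
product contribute equally. -/
lemma tensor_sum_symmetrize {a : Fin n → Fin n → Fin n → Fin n → ℝ} (hsymm : TensorSymmetric a)
    (ξ x : Fin n → ℝ) :
    ∑ k, ∑ j, ∑ α, ∑ β, a k j α β * ((ξ k * x α + ξ α * x k) / 2) *
      ((ξ j * x β + ξ β * x j) / 2) =
    ∑ k, ∑ j, viscousSymbol a ξ k j * (x j * x k) := by
  have h1 : ∀ (ζ : Fin n → Fin n → ℝ), ∑ k, ∑ j, ∑ α, ∑ β, a k j α β * (ξ k * x α) * ζ j β =
      ∑ k, ∑ j, ∑ α, ∑ β, a k j α β * (ξ α * x k) * ζ j β := fun ζ => by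
    rw [sum_swap_first_third]
    refine Finset.sum_congr rfl fun k _ => Finset.sum_congr rfl fun j _ =>
      Finset.sum_congr rfl fun α _ => Finset.sum_congr rfl fun β _ => ?_
    rw [(hsymm k j α β).1]
  have h2 : ∑ k, ∑ j, ∑ α, ∑ β, a k j α β * (ξ α * x k) * (ξ j * x β) =
      ∑ k, ∑ j, ∑ α, ∑ β, a k j α β * (ξ α * x k) * (ξ β * x j) := by
    refine Finset.sum_congr rfl fun k _ => ?_
    rw [sum_swap_first_third]
    refine Finset.sum_congr rfl fun j _ =>
      Finset.sum_congr rfl fun α _ => Finset.sum_congr rfl fun β _ => ?_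
    rw [(hsymm k j α β).2]
  have h3 : ∑ k, ∑ j, viscousSymbol a ξ k j * (x j * x k) =
      ∑ k, ∑ j, ∑ α, ∑ β, a k j α β * (ξ α * x k) * (ξ β * x j) := by
    simp only [viscousSymbol, Finset.sum_mul]
    refine Finset.sum_congr rfl fun k _ => Finset.sum_congr rfl fun j _ =>
      Finset.sum_congr rfl fun α _ => Finset.sum_congr rfl fun β _ => by ring
  have h4 := h1 fun j β => (ξ j * x β + ξ β * x j) / 2
  calc _ = ((∑ k, ∑ j, ∑ α, ∑ β, a k j α β * (ξ k * x α) * ((ξ j * x β + ξ β * x j) / 2)) +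
        ∑ k, ∑ j, ∑ α, ∑ β, a k j α β * (ξ α * x k) * ((ξ j * x β + ξ β * x j) / 2)) / 2 := by
        simp only [← Finset.sum_add_distrib, Finset.sum_div]
        refine Finset.sum_congr rfl fun k _ => Finset.sum_congr rfl fun j _ =>
          Finset.sum_congr rfl fun α _ => Finset.sum_congr rfl fun β _ => by ring
    _ = ((∑ k, ∑ j, ∑ α, ∑ β, a k j α β * (ξ α * x k) * (ξ j * x β)) +
        ∑ k, ∑ j, ∑ α, ∑ β, a k j α β * (ξ α * x k) * (ξ β * x j)) / 2 := by
        rw [h4, add_self_div_two]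
        simp only [← Finset.sum_add_distrib, Finset.sum_div]
        refine Finset.sum_congr rfl fun k _ => Finset.sum_congr rfl fun j _ =>
          Finset.sum_congr rfl fun α _ => Finset.sum_congr rfl fun β _ => by ring
    _ = _ := by rw [h2, h3, add_self_div_two]

/-- Coercivity of the symbol on vectors orthogonal to the frequency. -/
lemma viscousSymbol_coercive {a : Fin n → Fin n → Fin n → Fin n → ℝ} (hsymm : TensorSymmetric a)
    (hell : RelaxedElliptic a) : ∃ c : ℝ, 0 < c ∧ ∀ ξ x : Fin n → ℝ, ∑ k, ξ k * x k = 0 →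
      c * (∑ k, ξ k ^ 2) * ∑ k, x k ^ 2 ≤ ∑ k, ∑ j, viscousSymbol a ξ k j * (x j * x k) := by
  obtain ⟨C, hC, h⟩ := hell
  refine ⟨C⁻¹ / 2, by positivity, fun ξ x hx => ?_⟩
  have := h (Matrix.of fun k α => (ξ k * x α + ξ α * x k) / 2)
    (by ext i j; simp only [Matrix.transpose_apply, Matrix.of_apply]; ring)
    (by
      simp only [Matrix.trace, Matrix.diag, Matrix.of_apply, add_self_div_two]
      exact hx)
  simp only [Matrix.of_apply] at this
  rw [tensor_sum_symmetrize hsymm] at this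
  refine le_trans (le_of_eq ?_) this
  -- The squared norm of the symmetrised product is `(|ξ|²|x|² + (ξ·x)²) / 2`, and the last term
  -- vanishes; hence the constant `C⁻¹ / 2`.
  have hsum : ∑ k, ∑ α, ((ξ k * x α + ξ α * x k) / 2) ^ 2 =
      ((∑ k, ξ k ^ 2) * ∑ k, x k ^ 2) / 2 + (∑ k, ξ k * x k) * (∑ k, ξ k * x k) / 2 := by
    have e1 : (∑ k, ξ k ^ 2) * ∑ k, x k ^ 2 = ∑ k, ∑ α, ξ k ^ 2 * x α ^ 2 :=
      Finset.sum_mul_sum _ _ _ _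
    have e2 : (∑ k, ξ k ^ 2) * ∑ k, x k ^ 2 = ∑ k, ∑ α, ξ α ^ 2 * x k ^ 2 := by
      rw [e1, Finset.sum_comm]
    have e3 : (∑ k, ξ k * x k) * (∑ k, ξ k * x k) = ∑ k, ∑ α, ξ k * x k * (ξ α * x α) :=
      Finset.sum_mul_sum _ _ _ _
    have : ((∑ k, ξ k ^ 2) * ∑ k, x k ^ 2) / 2 = ((∑ k, ∑ α, ξ k ^ 2 * x α ^ 2) +
        ∑ k, ∑ α, ξ α ^ 2 * x k ^ 2) / 4 := by
      rw [← e1, ← e2]; ring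
    rw [this, e3]
    simp only [← Finset.sum_add_distrib, Finset.sum_div]
    refine Finset.sum_congr rfl fun k _ => Finset.sum_congr rfl fun α _ => by ring
  rw [hsum, hx]
  ring

lemma rho_sq_le {ξ : Fin n → ℤ} (hξ : ξ ≠ 0) : rho ξ ^ 2 ≤ 2 * ∑ j, (ξ j : ℝ) ^ 2 := by
  obtain ⟨j, hj⟩ := Function.ne_iff.1 hξ
  have h1 : (1 : ℝ) ≤ (ξ j : ℝ) ^ 2 := by
    have : 1 ≤ ξ j ^ 2 := Int.one_le_abs hj |> fun h => by nlinarith [sq_abs (ξ j)]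
    exact_mod_cast this
  have := Finset.single_le_sum (f := fun j => (ξ j : ℝ) ^ 2) (fun _ _ => sq_nonneg _)
    (Finset.mem_univ j)
  rw [rho_sq]
  linarith

lemma rho_le_sum_abs {ξ : Fin n → ℤ} (hξ : ξ ≠ 0) : rho ξ ≤ 2 * ∑ j, |(ξ j : ℝ)| := by
  have h : ∑ j, (ξ j : ℝ) ^ 2 ≤ rho ξ * ∑ j, |(ξ j : ℝ)| := by
    rw [Finset.mul_sum]
    refine Finset.sum_le_sum fun j _ => ?_
    rw [← sq_abs, sq]
    exact mul_le_mul_of_nonneg_right (abs_le_rho ξ j) (abs_nonneg _)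
  have h2 := rho_sq_le hξ
  have h3 := rho_pos ξ
  by_contra hcon
  rw [not_le] at hcon
  nlinarith

/-- Carries the real coercivity estimate over to complex vectors: a real form splits over real and
imaginary parts. -/
lemma re_sum_symbol_mul_conj (A : Fin n → Fin n → ℝ) (v : Fin n → ℂ) :
    (∑ k, (∑ j, (A k j : ℂ) * v j) * starRingEnd ℂ (v k)).re =
      ∑ k, ∑ j, A k j * ((v j).re * (v k).re) + ∑ k, ∑ j, A k j * ((v j).im * (v k).im) := by
  simp only [Complex.re_sum, Finset.sum_mul, ← Finset.sum_add_distrib]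
  refine Finset.sum_congr rfl fun k _ => Finset.sum_congr rfl fun j _ => ?_
  simp only [Complex.mul_re, Complex.mul_im, Complex.ofReal_re, Complex.ofReal_im,
    Complex.conj_re, Complex.conj_im]
  ring

lemma exists_abs_viscousSymbol_le (a : Fin n → Fin n → Fin n → Fin n → ℝ) :
    ∃ K : ℝ, 0 ≤ K ∧ ∀ (ξ : Fin n → ℤ) (k j : Fin n),
      |viscousSymbol a (fun i => (ξ i : ℝ)) k j| ≤ K * rho ξ ^ 2 := by
  refine ⟨∑ k, ∑ j, ∑ α, ∑ β, |a k j α β|, by positivity, fun ξ k j => ?_⟩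
  have h0 : |viscousSymbol a (fun i => (ξ i : ℝ)) k j| ≤
      ∑ α, ∑ β, |a k j α β| * rho ξ ^ 2 := by
    refine (Finset.abs_sum_le_sum_abs _ _).trans (Finset.sum_le_sum fun α _ => ?_)
    refine (Finset.abs_sum_le_sum_abs _ _).trans (Finset.sum_le_sum fun β _ => ?_)
    rw [abs_mul, abs_mul, sq]
    have h1 := abs_le_rho ξ α
    have h2 := abs_le_rho ξ β
    have h3 := (rho_pos ξ).le
    gcongr
  refine h0.trans ?_
  simp only [← Finset.sum_mul]
  refine mul_le_mul_of_nonneg_right ?_ (sq_nonneg _)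
  have h1 := Finset.single_le_sum (f := fun k => ∑ j, ∑ α, ∑ β, |a k j α β|)
    (fun _ _ => by positivity) (Finset.mem_univ k)
  have h2 := Finset.single_le_sum (f := fun j => ∑ α, ∑ β, |a k j α β|)
    (fun _ _ => by positivity) (Finset.mem_univ j)
  exact h2.trans h1

/-- The a priori estimate for the Stokes system at a single nonzero frequency. -/
lemma stokes_symbol_estimate {a : Fin n → Fin n → Fin n → Fin n → ℝ} (hsymm : TensorSymmetric a)
    (hell : RelaxedElliptic a) : ∃ A : ℝ, 0 ≤ A ∧ ∀ (ξ : Fin n → ℤ), ξ ≠ 0 →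
      ∀ (v : Fin n → ℂ) (q : ℂ) (F : Fin n → ℂ), ∑ j, (ξ j : ℂ) * v j = 0 →
      (∀ k, 4 * Real.pi ^ 2 * (∑ j, (viscousSymbol a (fun i => (ξ i : ℝ)) k j : ℂ) * v j) +
        2 * Real.pi * Complex.I * ξ k * q = F k) →
      rho ξ ^ 2 * ∑ k, ‖v k‖ ≤ A * ∑ k, ‖F k‖ ∧ rho ξ * ‖q‖ ≤ A * ∑ k, ‖F k‖ := by
  obtain ⟨c, hc, hcoer⟩ := viscousSymbol_coercive hsymm hell
  have hpi := Real.pi_pos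
  have hpi3 := Real.pi_gt_three
  obtain ⟨K, hK0, hK⟩ := exists_abs_viscousSymbol_le a
  -- The 2 comes from `ρ² ≤ 2|ξ|²`, the `n` from `(∑ ‖v k‖)² ≤ n ∑ ‖v k‖²`, the denominator from the
  -- energy estimate.
  obtain ⟨A₁, hA₁⟩ : ∃ A₁ : ℝ, A₁ = 2 * n / (4 * Real.pi ^ 2 * c) := ⟨_, rfl⟩
  have hA₁0 : 0 ≤ A₁ := hA₁ ▸ by positivity
  -- Solving each of the `n` equations for `ξ k * q` costs `F k` plus the viscous term, already
  -- bounded through `A₁`.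
  obtain ⟨A₂, hA₂⟩ : ∃ A₂ : ℝ, A₂ = n * (1 + 4 * Real.pi ^ 2 * K * A₁) := ⟨_, rfl⟩
  refine ⟨max A₁ A₂, le_max_of_le_left hA₁0, fun ξ hξ v q F hdiv hF => ?_⟩
  set Φ : ℝ := ∑ k, ‖F k‖ with hΦ
  set S : ℝ := ∑ k, ‖v k‖ with hS
  have hΦ0 : 0 ≤ Φ := by positivity
  have hS0 : 0 ≤ S := by positivity
  have hFk : ∀ k, ‖F k‖ ≤ Φ := fun k =>
    Finset.single_le_sum (f := fun k => ‖F k‖) (fun _ _ => norm_nonneg _) (Finset.mem_univ k)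
  have hvk : ∀ k, ‖v k‖ ≤ S := fun k =>
    Finset.single_le_sum (f := fun k => ‖v k‖) (fun _ _ => norm_nonneg _) (Finset.mem_univ k)
  have hre : ∑ k, (ξ k : ℝ) * (v k).re = 0 := by
    have := congrArg Complex.re hdiv
    simpa [Complex.re_sum] using this
  have him : ∑ k, (ξ k : ℝ) * (v k).im = 0 := by
    have := congrArg Complex.im hdiv
    simpa [Complex.im_sum] using this
  -- Pairing with the conjugate of `v` removes the pressure because `ξ`, being real, is also
  -- orthogonal to that conjugate.
  have henergy : 4 * Real.pi ^ 2 * (c * (∑ k, (ξ k : ℝ) ^ 2) * ∑ k, ‖v k‖ ^ 2) ≤ Φ * S := by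
    have h1 : (∑ k, F k * starRingEnd ℂ (v k)) = 4 * Real.pi ^ 2 *
        ∑ k, (∑ j, (viscousSymbol a (fun i => (ξ i : ℝ)) k j : ℂ) * v j) * starRingEnd ℂ (v k) := by
      have h2 : ∑ k, (ξ k : ℂ) * starRingEnd ℂ (v k) = 0 := by
        have := congrArg (starRingEnd ℂ) hdiv
        simpa [map_sum] using this
      calc _ = ∑ k, (4 * Real.pi ^ 2 *
            ((∑ j, (viscousSymbol a (fun i => (ξ i : ℝ)) k j : ℂ) * v j) * starRingEnd ℂ (v k)) +
            2 * Real.pi * Complex.I * q * ((ξ k : ℂ) * starRingEnd ℂ (v k))) :=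
            Finset.sum_congr rfl fun k _ => by rw [← hF k]; ring
        _ = _ := by
            rw [Finset.sum_add_distrib, ← Finset.mul_sum, ← Finset.mul_sum, h2, mul_zero, add_zero]
    have h3 : (∑ k, F k * starRingEnd ℂ (v k)).re = 4 * Real.pi ^ 2 *
        (∑ k, ∑ j, viscousSymbol a (fun i => (ξ i : ℝ)) k j * ((v j).re * (v k).re) +
          ∑ k, ∑ j, viscousSymbol a (fun i => (ξ i : ℝ)) k j * ((v j).im * (v k).im)) := by
      rw [h1, ← re_sum_symbol_mul_conj]
      rw [show (4 * Real.pi ^ 2 : ℂ) = ((4 * Real.pi ^ 2 : ℝ) : ℂ) by push_cast; ring]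
      exact Complex.re_ofReal_mul _ _
    have h4 : (∑ k, F k * starRingEnd ℂ (v k)).re ≤ Φ * S := by
      refine (Complex.re_le_norm _).trans ((norm_sum_le _ _).trans ?_)
      rw [hS, Finset.mul_sum]
      refine Finset.sum_le_sum fun k _ => ?_
      rw [norm_mul, RCLike.norm_conj]
      exact mul_le_mul_of_nonneg_right (hFk k) (norm_nonneg _)
    have h5 : ∑ k, ‖v k‖ ^ 2 = ∑ k, (v k).re ^ 2 + ∑ k, (v k).im ^ 2 := by
      rw [← Finset.sum_add_distrib]
      refine Finset.sum_congr rfl fun k _ => ?_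
      rw [← Complex.normSq_eq_norm_sq, Complex.normSq_apply]
      ring
    rw [h3] at h4
    refine le_trans ?_ h4
    rw [h5, mul_add]
    exact mul_le_mul_of_nonneg_left (add_le_add (hcoer _ _ hre) (hcoer _ _ him)) (by positivity)
  have hcs : S ^ 2 ≤ n * ∑ k, ‖v k‖ ^ 2 := by
    simpa using sq_sum_le_card_mul_sum_sq (s := Finset.univ) (f := fun k => ‖v k‖)
  have hrho := rho_sq_le hξ
  have hu : rho ξ ^ 2 * S ≤ A₁ * Φ := by
    rw [hA₁, div_mul_eq_mul_div, le_div_iff₀ (by positivity)]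
    rcases hS0.eq_or_lt with h0 | h0
    · rw [← h0]; simp; positivity
    · refine le_of_mul_le_mul_right ?_ h0
      calc rho ξ ^ 2 * S * (4 * Real.pi ^ 2 * c) * S
          = 4 * Real.pi ^ 2 * c * (rho ξ ^ 2 * S ^ 2) := by ring
        _ ≤ 4 * Real.pi ^ 2 * c * ((2 * ∑ j, (ξ j : ℝ) ^ 2) * (n * ∑ k, ‖v k‖ ^ 2)) := by
            gcongr
        _ = 2 * n * (4 * Real.pi ^ 2 * (c * (∑ k, (ξ k : ℝ) ^ 2) * ∑ k, ‖v k‖ ^ 2)) := by ring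
        _ ≤ 2 * n * (Φ * S) := by gcongr
        _ = 2 * n * Φ * S := by ring
  have hq : rho ξ * ‖q‖ ≤ A₂ * Φ := by
    have h1 : ∀ k, 2 * |(ξ k : ℝ)| * ‖q‖ ≤ (1 + 4 * Real.pi ^ 2 * K * A₁) * Φ := fun k => by
      have h2 : 2 * Real.pi * Complex.I * ξ k * q = F k -
          4 * Real.pi ^ 2 * (∑ j, (viscousSymbol a (fun i => (ξ i : ℝ)) k j : ℂ) * v j) := by
        rw [← hF k]; ring
      have h3 : ‖∑ j, (viscousSymbol a (fun i => (ξ i : ℝ)) k j : ℂ) * v j‖ ≤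
          K * (rho ξ ^ 2 * S) := by
        refine (norm_sum_le _ _).trans ?_
        rw [← mul_assoc, hS, Finset.mul_sum]
        refine Finset.sum_le_sum fun j _ => ?_
        rw [norm_mul, Complex.norm_real, Real.norm_eq_abs]
        exact mul_le_mul_of_nonneg_right (hK ξ k j) (norm_nonneg _)
      have h4 : 2 * Real.pi * (|(ξ k : ℝ)| * ‖q‖) ≤ ‖F k‖ + 4 * Real.pi ^ 2 *
          ‖∑ j, (viscousSymbol a (fun i => (ξ i : ℝ)) k j : ℂ) * v j‖ := by
        have := norm_sub_le (F k)
          (4 * Real.pi ^ 2 * (∑ j, (viscousSymbol a (fun i => (ξ i : ℝ)) k j : ℂ) * v j))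
        rw [← h2] at this
        simpa [abs_of_pos hpi, mul_assoc, Int.norm_eq_abs] using this
      calc 2 * |(ξ k : ℝ)| * ‖q‖ ≤ 2 * Real.pi * (|(ξ k : ℝ)| * ‖q‖) := by
            have : 0 ≤ |(ξ k : ℝ)| * ‖q‖ := by positivity
            nlinarith
        _ ≤ Φ + 4 * Real.pi ^ 2 * (K * (A₁ * Φ)) := by
            refine h4.trans (add_le_add (hFk k) ?_)
            gcongr
            exact h3.trans (by gcongr)
        _ = _ := by ring
    calc rho ξ * ‖q‖ ≤ (2 * ∑ j, |(ξ j : ℝ)|) * ‖q‖ := by gcongr; exact rho_le_sum_abs hξ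
      _ = ∑ k, 2 * |(ξ k : ℝ)| * ‖q‖ := by rw [Finset.mul_sum, Finset.sum_mul]
      _ ≤ ∑ k : Fin n, (1 + 4 * Real.pi ^ 2 * K * A₁) * Φ := Finset.sum_le_sum fun k _ => h1 k
      _ = A₂ * Φ := by simp [hA₂]; ring
  exact ⟨hu.trans (by gcongr; exact le_max_left _ _), hq.trans (by gcongr; exact le_max_right _ _)⟩

/-- Symmetry under `j ↔ β` makes the two halves of the strain contribute equally, which absorbs the
factor `1/2`. -/
lemma fourierCoeffD_viscous {a : Fin n → Fin n → Fin n → Fin n → ℝ} (hsymm : TensorSymmetric a)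
    (u : Fin n → PeriodicDistrib n) (k : Fin n) (ξ : Fin n → ℤ) :
    fourierCoeffD (viscous a u k) ξ = -(4 * Real.pi ^ 2 *
      ∑ j, (viscousSymbol a (fun i => (ξ i : ℝ)) k j : ℂ) * fourierCoeffD (u j) ξ) := by
  have hswap : ∑ j, ∑ α, ∑ β, (a k j α β : ℂ) * ξ α * (ξ j * fourierCoeffD (u β) ξ) =
      ∑ j, ∑ α, ∑ β, (a k j α β : ℂ) * ξ α * (ξ β * fourierCoeffD (u j) ξ) := by
    rw [sum_swap_first_third]
    refine Finset.sum_congr rfl fun j _ =>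
      Finset.sum_congr rfl fun α _ => Finset.sum_congr rfl fun β _ => ?_
    rw [(hsymm k j α β).2]
  have hsym : ∑ j, (viscousSymbol a (fun i => (ξ i : ℝ)) k j : ℂ) * fourierCoeffD (u j) ξ =
      ∑ j, ∑ α, ∑ β, (a k j α β : ℂ) * ξ α * (ξ β * fourierCoeffD (u j) ξ) := by
    simp only [viscousSymbol, Complex.ofReal_sum, Finset.sum_mul]
    refine Finset.sum_congr rfl fun j _ =>
      Finset.sum_congr rfl fun α _ => Finset.sum_congr rfl fun β _ => ?_
    push_cast
    ring
  calc fourierCoeffD (viscous a u k) ξ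
      = ∑ α, ∑ j, ∑ β, (-(2 * Real.pi ^ 2 : ℂ)) *
        ((a k j α β : ℂ) * ξ α * (ξ j * fourierCoeffD (u β) ξ) +
          (a k j α β : ℂ) * ξ α * (ξ β * fourierCoeffD (u j) ξ)) := by
        simp only [viscous, strain, fourierCoeffD_sum, fourierCoeffD_partialD, fourierCoeffD_smul,
          fourierCoeffD_add, Finset.mul_sum]
        refine Finset.sum_congr rfl fun j _ =>
          Finset.sum_congr rfl fun α _ => Finset.sum_congr rfl fun β _ => ?_
        -- The outer sum runs over the derivative index, so the bound names `j` and `α` are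
        -- interchanged here.
        linear_combination (2 * Real.pi ^ 2 * a k α j β * ξ j * (ξ α * fourierCoeffD (u β) ξ +
          ξ β * fourierCoeffD (u α) ξ) : ℂ) * Complex.I_sq
    _ = -(2 * Real.pi ^ 2 : ℂ) *
        (∑ j, ∑ α, ∑ β, (a k j α β : ℂ) * ξ α * (ξ j * fourierCoeffD (u β) ξ) +
          ∑ j, ∑ α, ∑ β, (a k j α β : ℂ) * ξ α * (ξ β * fourierCoeffD (u j) ξ)) := by
        rw [Finset.sum_comm]
        simp only [← Finset.mul_sum, ← Finset.sum_add_distrib]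
    _ = _ := by rw [hswap, hsym]; ring

lemma fourierCoeffD_neg_stokes {a : Fin n → Fin n → Fin n → Fin n → ℝ} (hsymm : TensorSymmetric a)
    (u : Fin n → PeriodicDistrib n) (p : PeriodicDistrib n) (k : Fin n) (ξ : Fin n → ℤ) :
    fourierCoeffD (-stokes a u p k) ξ = 4 * Real.pi ^ 2 *
      (∑ j, (viscousSymbol a (fun i => (ξ i : ℝ)) k j : ℂ) * fourierCoeffD (u j) ξ) +
        2 * Real.pi * Complex.I * ξ k * fourierCoeffD p ξ := by
  rw [stokes, fourierCoeffD_neg, fourierCoeffD_sub, fourierCoeffD_viscous hsymm,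
    fourierCoeffD_partialD]
  ring

lemma sum_freq_mul_fourierCoeffD {u : Fin n → PeriodicDistrib n} (hu : divergence u = 0)
    (ξ : Fin n → ℤ) : ∑ j, (ξ j : ℂ) * fourierCoeffD (u j) ξ = 0 := by
  have h : fourierCoeffD (divergence u) ξ = 0 := by rw [hu]; rfl
  rw [divergence, fourierCoeffD_sum] at h
  simp only [fourierCoeffD_partialD, mul_assoc (2 * Real.pi * Complex.I : ℂ)] at h
  rw [← Finset.mul_sum] at h
  exact (mul_eq_zero.1 h).resolve_left Complex.two_pi_I_ne_zero

end Symbol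

/-! ### Fourier coefficients of the convection term -/

section Convection

open scoped ENNReal

variable {n : ℕ}

lemma partialSmooth_partialSum (j : Fin n) (m : ℕ) (T : PeriodicDistrib n) :
    partialSmooth j (partialSum m T) = ∑ η ∈ latticeBall n m,
      (fourierCoeffD T η * (2 * Real.pi * Complex.I * η j)) • expo η := by
  simp only [partialSum, map_sum, map_smul, partialSmooth_expo, smul_smul]

lemma fourierCoeffD_ofSmooth_expo (η ξ : Fin n → ℤ) :
    fourierCoeffD (ofSmooth (expo η)) ξ = if η = ξ then 1 else 0 := by
  rw [fourierCoeffD, pair_ofSmooth, ← expo_add, integralCube_expo, ← sub_eq_add_neg]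
  simp only [sub_eq_zero]

lemma ofSmooth_add (g h : SmoothPeriodic n) : ofSmooth (g + h) = ofSmooth g + ofSmooth h := by
  ext φ
  change integralCube ((g + h) * φ) = integralCube (g * φ) + integralCube (h * φ)
  rw [add_mul, map_add]

lemma ofSmooth_smul (c : ℂ) (g : SmoothPeriodic n) : ofSmooth (c • g) = c • ofSmooth g := by
  ext φ
  change integralCube ((c • g) * φ) = c • integralCube (g * φ)
  rw [smul_mul_assoc, map_smul]

/-- `ofSmooth` as a linear map. -/
noncomputable def ofSmoothₗ (n : ℕ) : SmoothPeriodic n →ₗ[ℂ] PeriodicDistrib n where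
  toFun := ofSmooth
  map_add' := ofSmooth_add
  map_smul' := ofSmooth_smul

lemma ofSmooth_sum {κ : Type*} (s : Finset κ) (g : κ → SmoothPeriodic n) :
    ofSmooth (∑ k ∈ s, g k) = ∑ k ∈ s, ofSmooth (g k) := map_sum (ofSmoothₗ n) g s

lemma fourierCoeffD_convection (u : Fin n → PeriodicDistrib n) (k : Fin n) (m : ℕ)
    (ξ : Fin n → ℤ) :
    fourierCoeffD (ofSmooth (convectionSmooth (fun j => partialSum m (u j)) k)) ξ =
      ∑ η ∈ latticeBall n m, ∑ ζ ∈ latticeBall n m, if η + ζ = ξ then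
        ∑ j, fourierCoeffD (u j) η * (fourierCoeffD (u k) ζ * (2 * Real.pi * Complex.I * ζ j))
        else 0 := by
  simp only [convectionSmooth, partialSmooth_partialSum]
  simp only [partialSum, Finset.sum_mul_sum, smul_mul_smul_comm, ← expo_add, ofSmooth_sum,
    ofSmooth_smul, fourierCoeffD_sum, fourierCoeffD_smul, fourierCoeffD_ofSmooth_expo,
    mul_ite, mul_one, mul_zero]
  rw [Finset.sum_comm]
  refine Finset.sum_congr rfl fun η _ => ?_
  rw [Finset.sum_comm]
  refine Finset.sum_congr rfl fun ζ _ => ?_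
  split_ifs <;> simp

/-- The sum of the moduli of the Fourier coefficients of the components of a field. -/
noncomputable def coeffNorm (u : Fin n → PeriodicDistrib n) (ξ : Fin n → ℤ) : ℝ≥0∞ :=
  ∑ j, ‖fourierCoeffD (u j) ξ‖ₑ

lemma enorm_le_coeffNorm (u : Fin n → PeriodicDistrib n) (k : Fin n) (ξ : Fin n → ℤ) :
    ‖fourierCoeffD (u k) ξ‖ₑ ≤ coeffNorm u ξ :=
  Finset.single_le_sum (f := fun j => ‖fourierCoeffD (u j) ξ‖ₑ) (fun _ _ => zero_le)
    (Finset.mem_univ k)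

lemma enorm_intCast_le_weight (ξ : Fin n → ℤ) (j : Fin n) : ‖(ξ j : ℂ)‖ₑ ≤ weight ξ := by
  rw [← ofReal_norm, Complex.norm_intCast]
  exact ENNReal.ofReal_le_ofReal (abs_le_rho ξ j)

lemma enorm_fourierCoeffD_convection_le {u : Fin n → PeriodicDistrib n} (hu : divergence u = 0)
    (k : Fin n) (m : ℕ) (ξ : Fin n → ℤ) :
    ‖fourierCoeffD (ofSmooth (convectionSmooth (fun j => partialSum m (u j)) k)) ξ‖ₑ ≤
      ‖(2 * Real.pi * Complex.I : ℂ)‖ₑ * weight ξ * conv (coeffNorm u) (coeffNorm u) ξ := by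
  set c : ℂ := 2 * Real.pi * Complex.I with hc
  have hterm : ∀ η ζ : Fin n → ℤ, η + ζ = ξ →
      ‖∑ j, fourierCoeffD (u j) η * (fourierCoeffD (u k) ζ * (c * ζ j))‖ₑ ≤
        ‖c‖ₑ * weight ξ * (coeffNorm u ζ * coeffNorm u η) := by
    intro η ζ h
    -- Since `ζ = ξ - η` and `η · û(η) = 0`, the frequency `ζ` may be replaced by `ξ`. This is the
    -- divergence form of the convection term, and it takes the weight out of the convolution.
    have hsum : ∑ j, fourierCoeffD (u j) η * (fourierCoeffD (u k) ζ * (c * ζ j)) =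
        c * fourierCoeffD (u k) ζ * ∑ j, (ξ j : ℂ) * fourierCoeffD (u j) η := by
      have h0 := sum_freq_mul_fourierCoeffD hu η
      calc _ = c * fourierCoeffD (u k) ζ * (∑ j, (ξ j : ℂ) * fourierCoeffD (u j) η -
            ∑ j, (η j : ℂ) * fourierCoeffD (u j) η) := by
            rw [← Finset.sum_sub_distrib, Finset.mul_sum]
            refine Finset.sum_congr rfl fun j _ => ?_
            rw [← h]
            simp only [Pi.add_apply]
            push_cast
            ring
        _ = _ := by rw [h0, sub_zero]
    rw [hsum, enorm_mul, enorm_mul]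
    have h1 : ‖∑ j, (ξ j : ℂ) * fourierCoeffD (u j) η‖ₑ ≤ weight ξ * coeffNorm u η := by
      refine (enorm_sum_le _ _).trans ?_
      rw [coeffNorm, Finset.mul_sum]
      refine Finset.sum_le_sum fun j _ => ?_
      rw [enorm_mul]
      gcongr
      exact enorm_intCast_le_weight ξ j
    calc ‖c‖ₑ * ‖fourierCoeffD (u k) ζ‖ₑ * ‖∑ j, (ξ j : ℂ) * fourierCoeffD (u j) η‖ₑ
        ≤ ‖c‖ₑ * coeffNorm u ζ * (weight ξ * coeffNorm u η) := by
          gcongr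
          exact enorm_le_coeffNorm u k ζ
      _ = _ := by ring
  rw [fourierCoeffD_convection]
  calc _ ≤ ∑ η ∈ latticeBall n m, ∑ ζ ∈ latticeBall n m, if ζ = ξ - η then
        ‖c‖ₑ * weight ξ * (coeffNorm u ζ * coeffNorm u η) else 0 := by
        refine (enorm_sum_le _ _).trans (Finset.sum_le_sum fun η _ => ?_)
        refine (enorm_sum_le _ _).trans (Finset.sum_le_sum fun ζ _ => ?_)
        by_cases h : η + ζ = ξ
        · rw [if_pos h, if_pos (eq_sub_of_add_eq' h)]
          exact hterm η ζ h
        · rw [if_neg h]; simp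
    _ ≤ ∑ η ∈ latticeBall n m, ‖c‖ₑ * weight ξ * (coeffNorm u (ξ - η) * coeffNorm u η) := by
        refine Finset.sum_le_sum fun η _ => ?_
        rw [Finset.sum_ite_eq']
        split_ifs
        · exact le_rfl
        · exact zero_le
    _ ≤ _ := by
        rw [← Finset.mul_sum]
        gcongr
        exact ENNReal.sum_le_tsum _

/-- The Fourier coefficients of `(u·∇)u` are controlled by `|ξ|` times the self-convolution of the
coefficients of a solenoidal `u`. -/
lemma enorm_fourierCoeffD_le_of_isConvection {u b : Fin n → PeriodicDistrib n}
    (hu : divergence u = 0) (hb : IsConvection u b) (k : Fin n) (ξ : Fin n → ℤ) :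
    ‖fourierCoeffD (b k) ξ‖ₑ ≤
      ‖(2 * Real.pi * Complex.I : ℂ)‖ₑ * weight ξ * conv (coeffNorm u) (coeffNorm u) ξ :=
  -- The bound for the truncated fields does not depend on `m`, so it survives the limit.
  le_of_tendsto' (hb k (expo (-ξ))).enorm fun m => enorm_fourierCoeffD_convection_le hu k m ξ

end Convection

/-! ### Sobolev regularity of solutions -/

section Regularity

open scoped ENNReal

variable {n : ℕ}

lemma mem_Sobolev_iff {s : ℝ} {T : PeriodicDistrib n} :
    T ∈ Sobolev n s ↔ sobolevSq s (fun ξ => ‖fourierCoeffD T ξ‖ₑ) < ⊤ := by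
  have h : ∀ ξ : Fin n → ℤ, (weight ξ ^ s * ‖fourierCoeffD T ξ‖ₑ) ^ 2 =
      ENNReal.ofReal (rho ξ ^ (2 * s) * ‖fourierCoeffD T ξ‖ ^ 2) := fun ξ => by
    rw [weight, ENNReal.ofReal_rpow_of_pos (rho_pos ξ), ← ofReal_norm,
      ← ENNReal.ofReal_mul (Real.rpow_nonneg (rho_pos ξ).le _),
      ← ENNReal.ofReal_pow (mul_nonneg (Real.rpow_nonneg (rho_pos ξ).le _) (norm_nonneg _)),
      mul_pow, mul_comm 2 s, Real.rpow_mul (rho_pos ξ).le, Real.rpow_two]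
  simp only [sobolevSq, h]
  constructor
  · intro hT
    exact Summable.tsum_ofReal_lt_top hT
  · intro hT
    have := ENNReal.summable_toReal hT.ne
    refine this.congr fun ξ => ENNReal.toReal_ofReal ?_
    exact mul_nonneg (Real.rpow_nonneg (rho_pos ξ).le _) (sq_nonneg _)

lemma sobolevSq_coeffNorm_lt_top {s : ℝ} {u : Fin n → PeriodicDistrib n}
    (hu : ∀ k, u k ∈ Sobolev n s) : sobolevSq s (coeffNorm u) < ⊤ :=
  sobolevSq_sum_lt_top _ _ fun k _ => mem_Sobolev_iff.1 (hu k)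

lemma mem_Sobolev_of_le {s : ℝ} {T : PeriodicDistrib n} {V : (Fin n → ℤ) → ℝ≥0∞}
    (h : ∀ ξ, ‖fourierCoeffD T ξ‖ₑ ≤ V ξ) (hV : sobolevSq s V < ⊤) : T ∈ Sobolev n s :=
  mem_Sobolev_iff.2 ((sobolevSq_mono h).trans_lt hV)

/-- Fourier-side a priori estimate for solutions of the Navier–Stokes system. -/
lemma navierStokes_coeff_estimate {a : Fin n → Fin n → Fin n → Fin n → ℝ}
    (hsymm : TensorSymmetric a) (hell : RelaxedElliptic a) : ∃ A : ℝ≥0∞, A ≠ ⊤ ∧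
      ∀ (u : Fin n → PeriodicDistrib n) (p : PeriodicDistrib n) (f : Fin n → PeriodicDistrib n),
      divergence u = 0 → (∀ k, pair (u k) 1 = 0) → pair p 1 = 0 → SolvesNavierStokes a u p f →
      ∀ ξ, weight ξ ^ (2 : ℝ) * coeffNorm u ξ ≤
          A * (coeffNorm f ξ + weight ξ * conv (coeffNorm u) (coeffNorm u) ξ) ∧
        weight ξ * ‖fourierCoeffD p ξ‖ₑ ≤
          A * (coeffNorm f ξ + weight ξ * conv (coeffNorm u) (coeffNorm u) ξ) := by
  obtain ⟨A, hA0, hA⟩ := stokes_symbol_estimate hsymm hell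
  set M : ℝ≥0∞ := 1 + n * ‖(2 * Real.pi * Complex.I : ℂ)‖ₑ with hM
  refine ⟨ENNReal.ofReal A * M, ENNReal.mul_ne_top ENNReal.ofReal_ne_top ?_,
    fun u p f hdiv hu0 hp0 ⟨b, hb, heq⟩ ξ => ?_⟩
  · exact ENNReal.add_ne_top.2 ⟨by simp, ENNReal.mul_ne_top (by simp) enorm_ne_top⟩
  -- The symbol degenerates at the origin, but there the left-hand sides vanish by the zero-mean
  -- conditions.
  by_cases hξ : ξ = 0
  · subst hξ
    simp [coeffNorm, fourierCoeffD_zero_eq, hu0, hp0]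
  obtain ⟨h1, h2⟩ := hA ξ hξ (fun j => fourierCoeffD (u j) ξ) (fourierCoeffD p ξ)
    (fun k => fourierCoeffD (f k) ξ - fourierCoeffD (b k) ξ) (sum_freq_mul_fourierCoeffD hdiv ξ)
    (fun k => by rw [← fourierCoeffD_neg_stokes hsymm, heq, fourierCoeffD_sub])
  have hsum : ∀ v : Fin n → ℂ, ENNReal.ofReal (∑ k, ‖v k‖) = ∑ k, ‖v k‖ₑ := fun v => by
    rw [ENNReal.ofReal_sum_of_nonneg fun _ _ => norm_nonneg _]
    simp only [ofReal_norm]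
  have hrhs : ENNReal.ofReal (A * ∑ k, ‖fourierCoeffD (f k) ξ - fourierCoeffD (b k) ξ‖) ≤
      ENNReal.ofReal A * M *
        (coeffNorm f ξ + weight ξ * conv (coeffNorm u) (coeffNorm u) ξ) := by
    rw [ENNReal.ofReal_mul hA0, hsum, mul_assoc]
    gcongr
    calc ∑ k, ‖fourierCoeffD (f k) ξ - fourierCoeffD (b k) ξ‖ₑ
        ≤ ∑ k, (‖fourierCoeffD (f k) ξ‖ₑ + ‖(2 * Real.pi * Complex.I : ℂ)‖ₑ * weight ξ *
          conv (coeffNorm u) (coeffNorm u) ξ) := by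
          refine Finset.sum_le_sum fun k _ => enorm_sub_le.trans ?_
          gcongr
          exact enorm_fourierCoeffD_le_of_isConvection hdiv hb k ξ
      _ = coeffNorm f ξ + n * ‖(2 * Real.pi * Complex.I : ℂ)‖ₑ *
          (weight ξ * conv (coeffNorm u) (coeffNorm u) ξ) := by
          rw [Finset.sum_add_distrib]
          simp [coeffNorm, mul_assoc]
      _ ≤ M * coeffNorm f ξ + M * (weight ξ * conv (coeffNorm u) (coeffNorm u) ξ) := by
          gcongr
          · exact le_mul_of_one_le_left' le_self_add
          · exact le_add_self
      _ = _ := by ring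
  constructor
  · refine le_trans (le_of_eq ?_) ((ENNReal.ofReal_le_ofReal h1).trans hrhs)
    rw [ENNReal.ofReal_mul (sq_nonneg _), hsum, ENNReal.rpow_two, weight,
      ENNReal.ofReal_pow (rho_pos ξ).le]
    rfl
  · refine le_trans (le_of_eq ?_) ((ENNReal.ofReal_le_ofReal h2).trans hrhs)
    rw [ENNReal.ofReal_mul (rho_pos ξ).le, ofReal_norm, weight]

/-- Sobolev regularity of solutions. -/
lemma sobolev_regularity (hn : 2 ≤ n) {a : Fin n → Fin n → Fin n → Fin n → ℝ}
    (hsymm : TensorSymmetric a) (hell : RelaxedElliptic a)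
    {s₁ s₂ : ℝ} (hs₁ : -1 + (n : ℝ) / 2 < s₁) (hs₂ : s₁ < s₂)
    {u : Fin n → PeriodicDistrib n} {p : PeriodicDistrib n} {f : Fin n → PeriodicDistrib n}
    (hu : u ∈ SobolevDotSigma n s₁) (hp : p ∈ SobolevDot n (s₁ - 1))
    (hf : ∀ k, f k ∈ Sobolev n (s₂ - 2)) (hNS : SolvesNavierStokes a u p f) :
    u ∈ SobolevDotSigma n s₂ ∧ p ∈ SobolevDot n (s₂ - 1) := by
  obtain ⟨A, hA, hest⟩ := navierStokes_coeff_estimate hsymm hell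
  have h := hest u p f hu.2 (fun k => (hu.1 k).2) hp.2 hNS
  obtain ⟨h1, h2⟩ := sobolevSq_bootstrap hn hs₁ hs₂ hA (fun ξ => (h ξ).1)
    (sobolevSq_coeffNorm_lt_top fun k => (hu.1 k).1) (sobolevSq_coeffNorm_lt_top hf)
  refine ⟨⟨fun k => ⟨mem_Sobolev_of_le (enorm_le_coeffNorm u k) h1, (hu.1 k).2⟩, hu.2⟩, ?_, hp.2⟩
  -- With `u` at its final regularity, the pressure needs no iteration: `ρ |p̂|` is dominated by an
  -- `H^{s₂-2}` sequence.
  have h3 := (sobolevSq_mono fun ξ => (h ξ).2).trans_lt (sobolevSq_const_mul_lt_top hA h2)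
  rw [sobolevSq_weight_mul] at h3
  rw [mem_Sobolev_iff]
  convert h3 using 2
  ring

end Regularity

/-! ### Rapidly decaying coefficients and smooth periodic functions -/

section SmoothFunctions

variable {n : ℕ}

/-- Rapid decay of a function on the lattice `ℤⁿ`. -/
def RapidDecay (c : (Fin n → ℤ) → ℂ) : Prop :=
  ∀ N : ℕ, ∃ C : ℝ, ∀ ξ, rho ξ ^ N * ‖c ξ‖ ≤ C

lemma RapidDecay.summable_rpow {c : (Fin n → ℤ) → ℂ} (hc : RapidDecay c) (t : ℝ) :
    Summable fun ξ => rho ξ ^ t * ‖c ξ‖ := by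
  obtain ⟨N, hN⟩ := exists_nat_gt (t + n)
  obtain ⟨C, hC⟩ := hc N
  refine Summable.of_nonneg_of_le
    (fun ξ => mul_nonneg (Real.rpow_nonneg (rho_pos ξ).le _) (norm_nonneg _)) (fun ξ => ?_)
    ((summable_rho_rpow (n := n) (r := t - N) (by linarith)).mul_right C)
  calc rho ξ ^ t * ‖c ξ‖ = rho ξ ^ (t - N) * (rho ξ ^ N * ‖c ξ‖) := by
        rw [← mul_assoc, ← Real.rpow_natCast, ← Real.rpow_add (rho_pos ξ), sub_add_cancel]
    _ ≤ _ := mul_le_mul_of_nonneg_left (hC ξ) (Real.rpow_nonneg (rho_pos ξ).le _)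

lemma RapidDecay.summable_pow {c : (Fin n → ℤ) → ℂ} (hc : RapidDecay c) (N : ℕ) :
    Summable fun ξ => rho ξ ^ N * ‖c ξ‖ := by
  simpa using hc.summable_rpow N

lemma RapidDecay.mono {c d : (Fin n → ℤ) → ℂ} (hc : RapidDecay c) (h : ∀ ξ, ‖d ξ‖ ≤ ‖c ξ‖) :
    RapidDecay d := fun N => by
  obtain ⟨C, hC⟩ := hc N
  exact ⟨C, fun ξ => (mul_le_mul_of_nonneg_left (h ξ) (pow_nonneg (rho_pos ξ).le _)).trans (hC ξ)⟩

lemma RapidDecay.mem_Sobolev {T : PeriodicDistrib n} (hT : RapidDecay (fourierCoeffD T)) (s : ℝ) :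
    T ∈ Sobolev n s := by
  obtain ⟨C, hC⟩ := hT 0
  refine Summable.of_nonneg_of_le
    (fun ξ => mul_nonneg (Real.rpow_nonneg (rho_pos ξ).le _) (sq_nonneg _)) (fun ξ => ?_)
    ((hT.summable_rpow (2 * s)).mul_right C)
  rw [sq, ← mul_assoc]
  refine mul_le_mul_of_nonneg_left (by simpa using hC ξ) ?_
  exact mul_nonneg (Real.rpow_nonneg (rho_pos ξ).le _) (norm_nonneg _)

lemma rapidDecay_of_forall_mem_Sobolev {s₁ : ℝ} {T : PeriodicDistrib n}
    (hT : ∀ s, s₁ < s → T ∈ Sobolev n s) : RapidDecay (fourierCoeffD T) := fun N => by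
  set s : ℝ := max N (s₁ + 1)
  have h : Summable _ := hT s ((lt_add_one s₁).trans_le (le_max_right _ _))
  refine ⟨Real.sqrt (∑' ξ : Fin n → ℤ, rho ξ ^ (2 * s) * ‖fourierCoeffD T ξ‖ ^ 2), fun ξ => ?_⟩
  refine Real.le_sqrt_of_sq_le (le_trans ?_ (h.le_tsum ξ fun η _ =>
    mul_nonneg (Real.rpow_nonneg (rho_pos η).le _) (sq_nonneg _)))
  rw [mul_pow, mul_comm 2 s, Real.rpow_mul (rho_pos ξ).le, Real.rpow_two]
  refine mul_le_mul_of_nonneg_right (pow_le_pow_left₀ (pow_nonneg (rho_pos ξ).le _) ?_ 2)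
    (sq_nonneg _)
  rw [← Real.rpow_natCast]
  exact Real.rpow_le_rpow_of_exponent_le (one_le_rho ξ) (le_max_left _ _)

lemma exists_norm_fourierCoeffD_ofSmooth_le (g : SmoothPeriodic n) :
    ∃ C : ℝ, ∀ ξ, ‖fourierCoeffD (ofSmooth g) ξ‖ ≤ C := by
  refine ⟨∫ x in Set.univ.pi (fun _ : Fin n => Set.Ico (0 : ℝ) 1),
    ‖(g : (Fin n → ℝ) → ℂ) x‖, fun ξ => ?_⟩
  refine (norm_integral_le_integral_norm _).trans (le_of_eq ?_)
  refine integral_congr_ae (Eventually.of_forall fun x => ?_)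
  change ‖(g : (Fin n → ℝ) → ℂ) x * (expo (-ξ) : (Fin n → ℝ) → ℂ) x‖ = _
  rw [norm_mul, norm_expo_apply, mul_one]

/-- The operator `1 - Δ / 4π²` on smooth periodic functions, with symbol `ρ(ξ)²`. -/
noncomputable def besselSmooth (g : SmoothPeriodic n) : SmoothPeriodic n :=
  g - (4 * Real.pi ^ 2 : ℂ)⁻¹ • ∑ j, partialSmooth j (partialSmooth j g)

lemma fourierCoeffD_besselSmooth (g : SmoothPeriodic n) (ξ : Fin n → ℤ) :
    fourierCoeffD (ofSmooth (besselSmooth g)) ξ =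
      (rho ξ : ℂ) ^ 2 * fourierCoeffD (ofSmooth g) ξ := by
  have h1 : ofSmooth (besselSmooth g) = ofSmooth g -
      (4 * Real.pi ^ 2 : ℂ)⁻¹ • ∑ j, partialD j (partialD j (ofSmooth g)) := by
    simp only [partialD_ofSmooth, ← ofSmooth_sum, ← ofSmooth_smul]
    exact map_sub (ofSmoothₗ n) _ _
  have h2 : (rho ξ : ℂ) ^ 2 = 1 + ∑ j, (ξ j : ℂ) ^ 2 := by
    rw [← Complex.ofReal_pow, rho_sq]; push_cast; rfl
  have hpi : (Real.pi : ℂ) ≠ 0 := by exact_mod_cast Real.pi_ne_zero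
  rw [h1, fourierCoeffD_sub, fourierCoeffD_smul, fourierCoeffD_sum, h2, add_mul, one_mul,
    sub_eq_add_neg]
  congr 1
  rw [Finset.mul_sum, Finset.sum_mul, ← Finset.sum_neg_distrib]
  refine Finset.sum_congr rfl fun j _ => ?_
  rw [fourierCoeffD_partialD, fourierCoeffD_partialD]
  field_simp
  linear_combination (-4 * (ξ j : ℂ) ^ 2 * fourierCoeffD (ofSmooth g) ξ) * Complex.I_sq

/-- Coefficients of a smooth function are bounded, and each application of `besselSmooth` multiplies
them by `ρ²`. -/
lemma rapidDecay_ofSmooth (g : SmoothPeriodic n) : RapidDecay (fourierCoeffD (ofSmooth g)) := by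
  have key : ∀ (M : ℕ) (g : SmoothPeriodic n), ∃ C : ℝ, ∀ ξ,
      (rho ξ ^ 2) ^ M * ‖fourierCoeffD (ofSmooth g) ξ‖ ≤ C := by
    intro M
    induction M with
    | zero => intro g; simpa using exists_norm_fourierCoeffD_ofSmooth_le g
    | succ M ih =>
      intro g
      obtain ⟨C, hC⟩ := ih (besselSmooth g)
      refine ⟨C, fun ξ => le_trans (le_of_eq ?_) (hC ξ)⟩
      rw [fourierCoeffD_besselSmooth, norm_mul, norm_pow, Complex.norm_real,
        Real.norm_of_nonneg (rho_pos ξ).le, pow_succ, mul_assoc]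
  intro N
  obtain ⟨C, hC⟩ := key N g
  refine ⟨C, fun ξ => le_trans ?_ (hC ξ)⟩
  rw [← pow_mul]
  gcongr
  · exact one_le_rho ξ
  · omega

/-- A bound for the derivative of the exponentials, relative to the weight. -/
noncomputable def expoConst (n : ℕ) : ℝ := 2 * Real.pi * n + 1

lemma one_le_expoConst_mul_rho (ξ : Fin n → ℤ) : 1 ≤ expoConst n * rho ξ := by
  have h : 1 ≤ expoConst n := by
    rw [expoConst]; have := Real.pi_pos; simp; positivity
  exact one_le_mul_of_one_le_of_one_le h (one_le_rho ξ)

lemma norm_phase_le (ξ : Fin n → ℤ) : ‖phase ξ‖ ≤ expoConst n * rho ξ := by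
  refine ContinuousLinearMap.opNorm_le_bound _ (zero_le_one.trans (one_le_expoConst_mul_rho ξ))
    fun x => ?_
  have hpi := Real.pi_pos
  rw [phase_apply, norm_mul, Complex.norm_real]
  have h1 : ‖(2 * Real.pi * Complex.I : ℂ)‖ = 2 * Real.pi := by simp [abs_of_pos hpi]
  have h2 : ‖∑ j, x j * (ξ j : ℝ)‖ ≤ n * (‖x‖ * rho ξ) := by
    refine (norm_sum_le _ _).trans ((Finset.sum_le_card_nsmul _ _ (‖x‖ * rho ξ)
      fun j _ => ?_).trans (by simp))
    rw [norm_mul]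
    exact mul_le_mul (norm_le_pi_norm x j) (abs_le_rho ξ j) (norm_nonneg _) (norm_nonneg _)
  rw [h1, expoConst]
  have h3 : 0 ≤ rho ξ * ‖x‖ := mul_nonneg (rho_pos ξ).le (norm_nonneg _)
  calc 2 * Real.pi * ‖∑ j, x j * (ξ j : ℝ)‖ ≤ 2 * Real.pi * (n * (‖x‖ * rho ξ)) := by gcongr
    _ ≤ _ := by nlinarith

lemma norm_iteratedFDeriv_expo_le (ξ : Fin n → ℤ) (k : ℕ) (x : Fin n → ℝ) :
    ‖iteratedFDeriv ℝ k (expo ξ : (Fin n → ℝ) → ℂ) x‖ ≤ (expoConst n * rho ξ) ^ k := by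
  induction k generalizing x with
  | zero => simp [norm_expo_apply]
  | succ k ih =>
    rw [← norm_iteratedFDeriv_fderiv]
    set L : ℂ →L[ℝ] ((Fin n → ℝ) →L[ℝ] ℂ) :=
      ContinuousLinearMap.smulRight (ContinuousLinearMap.id ℝ ℂ) (phase ξ) with hL
    have h : fderiv ℝ (expo ξ : (Fin n → ℝ) → ℂ) = L ∘ (expo ξ : (Fin n → ℝ) → ℂ) :=
      funext fun x => (hasFDerivAt_expo ξ x).fderiv
    rw [h, pow_succ']
    refine (L.norm_iteratedFDeriv_comp_left (expo ξ).2.1.contDiffAt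
      (by exact_mod_cast le_top)).trans ?_
    refine mul_le_mul ?_ (ih x) (norm_nonneg _) (zero_le_one.trans (one_le_expoConst_mul_rho ξ))
    refine (ContinuousLinearMap.opNorm_le_bound _ (norm_nonneg _) fun z => ?_).trans
      (norm_phase_le ξ)
    rw [hL]
    change ‖z • phase ξ‖ ≤ _
    rw [norm_smul, mul_comm]

/-- The majorant for the `k`-th derivative of `c ξ • e_ξ`. -/
noncomputable def majorant (c : (Fin n → ℤ) → ℂ) (k : ℕ) (ξ : Fin n → ℤ) : ℝ :=
  (expoConst n * rho ξ) ^ k * ‖c ξ‖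

lemma majorant_mono (c : (Fin n → ℤ) → ℂ) {k l : ℕ} (h : k ≤ l) (ξ : Fin n → ℤ) :
    majorant c k ξ ≤ majorant c l ξ :=
  mul_le_mul_of_nonneg_right (pow_le_pow_right₀ (one_le_expoConst_mul_rho ξ) h) (norm_nonneg _)

lemma RapidDecay.summable_majorant {c : (Fin n → ℤ) → ℂ} (hc : RapidDecay c) (k : ℕ) :
    Summable (majorant c k) := by
  refine ((hc.summable_pow k).mul_left (expoConst n ^ k)).congr fun ξ => ?_
  rw [majorant, mul_pow, mul_assoc]

lemma norm_iteratedFDeriv_smul_expo_le (c : (Fin n → ℤ) → ℂ) (k : ℕ) (ξ : Fin n → ℤ)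
    (x : Fin n → ℝ) : ‖iteratedFDeriv ℝ k
      (fun x => c ξ * (expo ξ : (Fin n → ℝ) → ℂ) x) x‖ ≤ majorant c k ξ := by
  change ‖iteratedFDeriv ℝ k (c ξ • (expo ξ : (Fin n → ℝ) → ℂ)) x‖ ≤ _
  rw [iteratedFDeriv_const_smul_apply ((expo ξ).2.1.contDiffAt.of_le (by exact_mod_cast le_top)),
    norm_smul, mul_comm]
  exact mul_le_mul_of_nonneg_right (norm_iteratedFDeriv_expo_le ξ k x) (norm_nonneg _)

/-- The smooth periodic function `∑ c ξ e_ξ` with rapidly decaying coefficients. -/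
noncomputable def synth (c : (Fin n → ℤ) → ℂ) (hc : RapidDecay c) : SmoothPeriodic n :=
  ⟨fun x => ∑' ξ, c ξ * (expo ξ : (Fin n → ℝ) → ℂ) x,
    contDiff_tsum (N := ⊤) (v := majorant c) (fun ξ => contDiff_const.mul (expo ξ).2.1)
      (fun k _ => hc.summable_majorant k)
      (fun k ξ x _ => norm_iteratedFDeriv_smul_expo_le c k ξ x),
    fun x η => tsum_congr fun ξ => by rw [(expo ξ).2.2 x η]⟩

lemma synth_apply (c : (Fin n → ℤ) → ℂ) (hc : RapidDecay c) (x : Fin n → ℝ) :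
    (synth c hc : (Fin n → ℝ) → ℂ) x = ∑' ξ, c ξ * (expo ξ : (Fin n → ℝ) → ℂ) x := rfl

lemma summable_synth {c : (Fin n → ℤ) → ℂ} (hc : RapidDecay c) (x : Fin n → ℝ) :
    Summable fun ξ => c ξ * (expo ξ : (Fin n → ℝ) → ℂ) x := by
  refine Summable.of_norm (((hc.summable_pow 0)).congr fun ξ => ?_)
  rw [norm_mul, norm_expo_apply]
  simp

lemma norm_iteratedFDeriv_synth_le (c : (Fin n → ℤ) → ℂ) (hc : RapidDecay c) (k : ℕ)
    (x : Fin n → ℝ) :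
    ‖iteratedFDeriv ℝ k (synth c hc : (Fin n → ℝ) → ℂ) x‖ ≤ ∑' ξ, majorant c k ξ := by
  change ‖iteratedFDeriv ℝ k (fun x => ∑' ξ, c ξ * (expo ξ : (Fin n → ℝ) → ℂ) x) x‖ ≤ _
  rw [iteratedFDeriv_tsum_apply (N := ⊤) (v := majorant c)
    (fun ξ => contDiff_const.mul (expo ξ).2.1) (fun k _ => hc.summable_majorant k)
    (fun k ξ x _ => norm_iteratedFDeriv_smul_expo_le c k ξ x) le_top]
  exact tsum_of_norm_bounded (hc.summable_majorant k).hasSum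
    fun ξ => norm_iteratedFDeriv_smul_expo_le c k ξ x

/-- A periodic distribution acts on `∑ c ξ e_ξ` term by term. -/
lemma hasSum_pair_synth (T : PeriodicDistrib n) (c : (Fin n → ℤ) → ℂ) (hc : RapidDecay c) :
    HasSum (fun ξ => c ξ * pair T (expo ξ)) (pair T (synth c hc)) := by
  classical
  obtain ⟨N, C, hC, hT⟩ := T.2
  have hlim : Tendsto (fun S : Finset (Fin n → ℤ) =>
      C * (∑' ξ, majorant c N ξ - ∑ ξ ∈ S, majorant c N ξ)) atTop (𝓝 0) := by
    have h := ((hc.summable_majorant N).hasSum.const_sub (∑' ξ, majorant c N ξ)).const_mul C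
    simpa using h
  refine tendsto_iff_norm_sub_tendsto_zero.2 (squeeze_zero (fun _ => norm_nonneg _) (fun S => ?_)
    hlim)
  -- The remainder is the series with coefficients `d`. Its derivatives up to order `N` are bounded
  -- by the tail of the majorant, and continuity of `T` needs no more.
  set d : (Fin n → ℤ) → ℂ := fun ξ => if ξ ∈ S then 0 else c ξ with hd
  have hdc : RapidDecay d := hc.mono fun ξ => by
    rw [hd]; dsimp only; split_ifs <;> simp
  have hsplit : synth c hc - ∑ ξ ∈ S, c ξ • expo ξ = synth d hdc := by
    ext x
    have h1 : ((synth c hc - ∑ ξ ∈ S, c ξ • expo ξ : SmoothPeriodic n) : (Fin n → ℝ) → ℂ) x =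
        (synth c hc : (Fin n → ℝ) → ℂ) x - ∑ ξ ∈ S, c ξ * (expo ξ : (Fin n → ℝ) → ℂ) x := by
      simp
    rw [h1, synth_apply, synth_apply, sub_eq_iff_eq_add']
    have h2 : HasSum (fun ξ => if ξ ∈ S then c ξ * (expo ξ : (Fin n → ℝ) → ℂ) x else 0)
        (∑ ξ ∈ S, c ξ * (expo ξ : (Fin n → ℝ) → ℂ) x) := by
      have := hasSum_sum_of_ne_finset_zero (s := S) (L := SummationFilter.unconditional _)
        (f := fun ξ => if ξ ∈ S then c ξ * (expo ξ : (Fin n → ℝ) → ℂ) x else 0)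
        (fun ξ hξ => if_neg hξ)
      rwa [Finset.sum_congr rfl fun ξ hξ => if_pos hξ] at this
    refine ((h2.add (summable_synth hdc x).hasSum).congr_fun fun ξ => ?_).tsum_eq
    rw [hd]
    dsimp only
    split_ifs <;> simp
  have hM : ∑' ξ, majorant d N ξ = ∑' ξ, majorant c N ξ - ∑ ξ ∈ S, majorant c N ξ := by
    rw [eq_sub_iff_add_eq']
    have h2 : HasSum (fun ξ => if ξ ∈ S then majorant c N ξ else 0)
        (∑ ξ ∈ S, majorant c N ξ) := by
      have := hasSum_sum_of_ne_finset_zero (s := S) (L := SummationFilter.unconditional _)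
        (f := fun ξ => if ξ ∈ S then majorant c N ξ else 0) (fun ξ hξ => if_neg hξ)
      rwa [Finset.sum_congr rfl fun ξ hξ => if_pos hξ] at this
    refine ((h2.add (hdc.summable_majorant N).hasSum).congr_fun fun ξ => ?_).tsum_eq.symm
    rw [hd]
    simp only [majorant]
    split_ifs <;> simp
  have hTsum : ∑ ξ ∈ S, c ξ * pair T (expo ξ) - pair T (synth c hc) = -pair T (synth d hdc) := by
    rw [← hsplit]
    simp only [pair, map_sub, map_sum, map_smul, smul_eq_mul, neg_sub]
  rw [hTsum, norm_neg, ← hM]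
  exact hT _ _ fun m hm x => (norm_iteratedFDeriv_synth_le d hdc m x).trans
    ((hdc.summable_majorant m).tsum_le_tsum (majorant_mono d hm) (hdc.summable_majorant N))

/-- Term-by-term action of the distribution given by `expo (-ξ)`, then orthogonality of the
exponentials. -/
lemma fourierCoeffD_ofSmooth_synth (c : (Fin n → ℤ) → ℂ) (hc : RapidDecay c) :
    fourierCoeffD (ofSmooth (synth c hc)) = c := by
  ext ξ
  have h := hasSum_pair_synth (ofSmooth (expo (-ξ))) c hc
  simp only [pair_ofSmooth, ← expo_add, integralCube_expo, neg_add_eq_zero, mul_ite, mul_one,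
    mul_zero] at h
  rw [mul_comm, ← pair_ofSmooth] at h
  have h2 : HasSum (fun η => if ξ = η then c η else 0) (if ξ = ξ then c ξ else 0) :=
    hasSum_single ξ fun η hη => if_neg hη.symm
  rw [if_pos rfl] at h2
  exact h.unique h2

lemma mFourier_coe (ξ : Fin n → ℤ) (x : Fin n → ℝ) :
    UnitAddTorus.mFourier ξ (fun i => (x i : UnitAddCircle)) = (expo ξ : (Fin n → ℝ) → ℂ) x := by
  change ∏ i, fourier (ξ i) (x i : UnitAddCircle) = _
  simp only [fourier_coe_apply]
  rw [← Complex.exp_sum, expo_apply]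
  congr 1
  push_cast
  rw [Finset.mul_sum]
  refine Finset.sum_congr rfl fun i _ => ?_
  simp
  ring

/-- Bridge to Fourier series on the quotient torus: points with equal image differ by an integer
vector, so `φ` descends, and continuity descends along the quotient map. -/
lemma exists_torus_lift (φ : SmoothPeriodic n) : ∃ F : C(UnitAddTorus (Fin n), ℂ),
    ∀ x : Fin n → ℝ, F (fun i => (x i : UnitAddCircle)) = (φ : (Fin n → ℝ) → ℂ) x := by
  let π : (Fin n → ℝ) → UnitAddTorus (Fin n) := fun x i => (x i : UnitAddCircle)
  have hπ : IsOpenQuotientMap π :=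
    IsOpenQuotientMap.piMap fun _ => QuotientAddGroup.isOpenQuotientMap_mk
  let r := Function.surjInv hπ.surjective
  have hr : ∀ x, (φ : (Fin n → ℝ) → ℂ) (r (π x)) = (φ : (Fin n → ℝ) → ℂ) x := fun x => by
    have h : π (r (π x)) = π x := Function.surjInv_eq hπ.surjective _
    have h2 : ∀ i, ∃ m : ℤ, r (π x) i = x i + m := fun i => by
      have h3 : ((r (π x) i - x i : ℝ) : UnitAddCircle) = 0 := by
        rw [AddCircle.coe_sub, sub_eq_zero]
        exact congrFun h i
      obtain ⟨m, hm⟩ := (AddCircle.coe_eq_zero_iff 1).1 h3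
      exact ⟨m, by simp at hm; linarith⟩
    choose m hm using h2
    rw [← φ.2.2 x m]
    exact congrArg _ (funext hm)
  refine ⟨⟨fun t => (φ : (Fin n → ℝ) → ℂ) (r t), ?_⟩, hr⟩
  rw [hπ.isQuotientMap.continuous_iff]
  exact φ.2.1.continuous.congr fun x => (hr x).symm

/-- A smooth periodic function is the sum of its Fourier series. -/
lemma synth_fourierCoeffD (φ : SmoothPeriodic n) :
    synth (fourierCoeffD (ofSmooth φ)) (rapidDecay_ofSmooth φ) = φ := by
  obtain ⟨F, hF⟩ := exists_torus_lift φ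
  have hcoeff : UnitAddTorus.mFourierCoeff F = fourierCoeffD (ofSmooth φ) := by
    ext ξ
    rw [UnitAddTorus.mFourierCoeff_eq_integral F ξ 0, fourierCoeffD, pair_ofSmooth,
      integralCube_eq_Icc]
    have hset : ({x : Fin n → ℝ | ∀ i, x i ∈ Set.Ioc ((0 : Fin n → ℝ) i)
        ((0 : Fin n → ℝ) i + 1)} : Set (Fin n → ℝ)) =ᵐ[volume] Set.Icc (0 : Fin n → ℝ) 1 := by
      have := Measure.univ_pi_Ioc_ae_eq_Icc (μ := fun _ : Fin n => (volume : Measure ℝ))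
        (f := fun _ => (0 : ℝ)) (g := fun _ => 1)
      have hpi : {x : Fin n → ℝ | ∀ i, x i ∈ Set.Ioc ((0 : Fin n → ℝ) i)
          ((0 : Fin n → ℝ) i + 1)} = Set.univ.pi fun _ => Set.Ioc (0 : ℝ) 1 := by
        ext x
        simp
      rw [hpi]
      exact this
    rw [setIntegral_congr_set hset]
    refine integral_congr_ae (Eventually.of_forall fun x => ?_)
    simp only [mFourier_coe, hF]
    exact mul_comm _ _
  -- Absolute summability gives convergence of the Fourier series at every point, not merely in
  -- `L²`.
  have hsum : Summable (UnitAddTorus.mFourierCoeff F) := by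
    rw [hcoeff]
    exact Summable.of_norm (by simpa using (rapidDecay_ofSmooth φ).summable_pow 0)
  ext x
  have h := UnitAddTorus.hasSum_mFourier_series_apply_of_summable hsum
    (fun i => (x i : UnitAddCircle))
  simp only [mFourier_coe, hF, hcoeff] at h
  exact h.tsum_eq

/-- A periodic distribution is determined by its Fourier coefficients. -/
lemma eq_of_fourierCoeffD_eq {S T : PeriodicDistrib n} (h : fourierCoeffD S = fourierCoeffD T) :
    S = T := by
  ext φ
  change pair S φ = pair T φ
  -- Both distributions act term by term on the Fourier series of the test function.
  rw [← synth_fourierCoeffD φ]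
  have hpair : ∀ ξ, pair S (expo ξ) = pair T (expo ξ) := fun ξ => by
    simpa [fourierCoeffD] using congrFun h (-ξ)
  refine (hasSum_pair_synth S _ _).unique ?_
  simp only [hpair]
  exact hasSum_pair_synth T _ _

lemma mem_SmoothDot_of_rapidDecay {T : PeriodicDistrib n} (hT : RapidDecay (fourierCoeffD T))
    (h0 : pair T 1 = 0) : T ∈ SmoothDot n := by
  have h : T = ofSmooth (synth _ hT) :=
    eq_of_fourierCoeffD_eq (fourierCoeffD_ofSmooth_synth _ hT).symm
  refine ⟨synth _ hT, ?_, h⟩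
  rw [h, pair_ofSmooth, mul_one] at h0
  exact h0

end SmoothFunctions

end PeriodicNS

open PeriodicNS
theorem theorem5 (n : ℕ) (hn : 2 ≤ n)
    (a : Fin n → Fin n → Fin n → Fin n → ℝ)
    (hsymm : TensorSymmetric a) (hell : RelaxedElliptic a)
    (s₁ s₂ : ℝ) (hs₁ : -1 + (n : ℝ) / 2 < s₁) (hs₂ : s₁ < s₂) :
    (∀ (u : Fin n → PeriodicDistrib n) (p : PeriodicDistrib n) (f : Fin n → PeriodicDistrib n),
      u ∈ SobolevDotSigma n s₁ → p ∈ SobolevDot n (s₁ - 1) → f ∈ SobolevDotVec n (s₂ - 2) →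
      SolvesNavierStokes a u p f →
        u ∈ SobolevDotSigma n s₂ ∧ p ∈ SobolevDot n (s₂ - 1)) ∧
    (∀ (u : Fin n → PeriodicDistrib n) (p : PeriodicDistrib n) (f : Fin n → PeriodicDistrib n),
      u ∈ SobolevDotSigma n s₁ → p ∈ SobolevDot n (s₁ - 1) → (∀ k, f k ∈ SmoothDot n) →
      SolvesNavierStokes a u p f →
        (∀ k, u k ∈ SmoothDot n) ∧ p ∈ SmoothDot n) := by
  refine ⟨fun u p f hu hp hf hNS => sobolev_regularity hn hsymm hell hs₁ hs₂ hu hp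
    (fun k => (hf k).1) hNS, fun u p f hu hp hf hNS => ?_⟩
  have hf' : ∀ s k, f k ∈ Sobolev n s := fun s k => by
    obtain ⟨g, -, hg⟩ := hf k
    rw [hg]
    exact (rapidDecay_ofSmooth g).mem_Sobolev s
  -- Smooth data lie in every Sobolev space, so the target exponent is arbitrary.
  have hreg : ∀ s, s₁ < s → u ∈ SobolevDotSigma n s ∧ p ∈ SobolevDot n (s - 1) := fun s hs =>
    sobolev_regularity hn hsymm hell hs₁ hs hu hp (hf' _) hNS
  refine ⟨fun k => mem_SmoothDot_of_rapidDecay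
    (rapidDecay_of_forall_mem_Sobolev fun s hs => ((hreg s hs).1.1 k).1) (hu.1 k).2,
    mem_SmoothDot_of_rapidDecay (rapidDecay_of_forall_mem_Sobolev (s₁ := s₁ - 1) fun s hs => ?_)
      hp.2⟩
  have := (hreg (s + 1) (by linarith)).2.1
  rwa [add_sub_cancel_right] at this
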